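/- All graphs are finite and simple. A connected graph with $n$ vertices and $n+c-1$ edges is called a tree, a unicyclic graph or a bicyclic graph when $c=0$, $1$ or $2$, respectively. A pendant vertex is a vertex of degree $1$. A symmetric function $f(x,y)$ on the positive reals is called \emph{escalating} if $f(x_1,x_2)+f(y_1,y_2)\ge f(x_2,y_1)+f(x_1,y_2)$ for all $x_1\ge y_1>0$ and $x_2\ge y_2>0$, with strict inequality if $x_1>y_1$ and $x_2>y_2$. It is called \emph{good escalating} if moreover it is twice differentiable in $x$ with $\frac{\partial f}{\partial x}>0$ and $\frac{\partial^2 f}{\partial x^2}\ge 0$ on the positive reals, and $f(x_1+1,x_2)+f(x_1+1,y_1-1)\ge f(x_2,y_1)+f(x_1,y_1)$ for all reals $x_1\ge y_1>1$ and $x_2\ge 1$. For a graph $G$ put $M_f(G)=\sum_{uv\in E(G)} f(d(u),d(v))$, where $d(v)$ is the degree of $v$. For an escalating $f$, a graph in a class of graphs is \emph{extremal} in that class if it maximizes $M_f$ over the class. Write $P_l$ for the path with $l$ vertices. Attaching the paths $P_{l_1},\dots,P_{l_k}$ to a vertex $r$ means joining $r$ by an edge to one end vertex of each of them; the paths have almost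 equal lengths if $l_i\ge 1$ and $|l_i-l_j|\le 1$ for all $i,j$. Let $B_2$ be the bicyclic graph on five vertices that consists of two triangles sharing one vertex, and let $C_3$ be the triangle. Let $f$ be good escalating and let $k\ge 1$ and $n$ be integers. (i) If $n\ge k+5$, let $F''_n(k)$ be the graph on $n$ vertices obtained by attaching $k$ paths of almost equal lengths to the vertex of degree four of $B_2$. This graph exists and is extremal among all bicyclic graphs with $n$ vertices and $k$ pendant vertices. (ii) If $n\ge k+3$, let $F'_n(k)$ be the graph on $n$ vertices obtained by attaching $k$ paths of almost equal lengths to one vertex of $C_3$. This graph exists and is extremal among all unicyclic graphs with $n$ vertices and $k$ pendant vertices. (iii) If $k\ge 2$ and $n\ge k+1$, let $F_n(k)$ be the graph on $n$ vertices obtained by attaching $k$ paths of almost equal lengths to an isolated vertex. This graph exists and is extremal among all trees with $n$ vertices and $k$ pendant vertices. In each case the extremal graph belongs to the class in question. -/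

import Mathlib

open scoped BigOperators

/-- `f` is *escalating*: a symmetric function of two positive real variables with the (strict)
rearrangement inequality. Only the values of `f` at positive arguments matter: a symmetric function
on the positive reals is represented by any symmetric extension of it, such as the one by `0`. -/
structure IsEscalating (f : ℝ → ℝ → ℝ) : Prop where
  symm : ∀ x y : ℝ, f x y = f y x
  ineq : ∀ x₁ y₁ x₂ y₂ : ℝ, 0 < y₁ → y₁ ≤ x₁ → 0 < y₂ → y₂ ≤ x₂ →
    f x₂ y₁ + f x₁ y₂ ≤ f x₁ x₂ + f y₁ y₂
  strict : ∀ x₁ y₁ x₂ y₂ : ℝ, 0 < y₁ → y₁ < x₁ → 0 < y₂ → y₂ < x₂ →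
    f x₂ y₁ + f x₁ y₂ < f x₁ x₂ + f y₁ y₂

/-- `f` is *good escalating*: escalating, twice differentiable in the first variable on the positive
reals with `∂f/∂x > 0` and `∂²f/∂x² ≥ 0`, and subject to one further inequality, which is required
whenever all its arguments are positive (that is, for `y₁ > 1`). -/
structure IsGoodEscalating (f : ℝ → ℝ → ℝ) : Prop extends IsEscalating f where
  differentiable : ∀ x y : ℝ, 0 < x → 0 < y → DifferentiableAt ℝ (fun t => f t y) x
  deriv_pos : ∀ x y : ℝ, 0 < x → 0 < y → 0 < deriv (fun t => f t y) x
  differentiable_deriv : ∀ x y : ℝ, 0 < x → 0 < y →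
    DifferentiableAt ℝ (deriv (fun t => f t y)) x
  deriv_deriv_nonneg : ∀ x y : ℝ, 0 < x → 0 < y → 0 ≤ deriv (deriv (fun t => f t y)) x
  shift : ∀ x₁ y₁ x₂ : ℝ, 1 < y₁ → y₁ ≤ x₁ → 1 ≤ x₂ →
    f x₂ y₁ + f x₁ y₁ ≤ f (x₁ + 1) x₂ + f (x₁ + 1) (y₁ - 1)

open Classical in
/-- The connectivity function `M_f(G) = ∑_{uv ∈ E(G)} f (d(u), d(v))`. -/
noncomputable def connectivityFunction (f : ℝ → ℝ → ℝ) (hf : ∀ x y : ℝ, f x y = f y x)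
    {V : Type*} [Fintype V] (G : SimpleGraph V) : ℝ :=
  ∑ e ∈ G.edgeFinset,
    Sym2.lift ⟨fun u v : V => f (G.degree u : ℝ) (G.degree v : ℝ), fun _ _ => hf _ _⟩ e

open Classical in
/-- A `c`-cyclic graph: a connected graph with `m = n + c - 1` edges, `n` being the number of
vertices. Trees, unicyclic graphs and bicyclic graphs are the cases `c = 0`, `1` and `2`. -/
def IsCyclicGraph (c : ℕ) {V : Type*} [Fintype V] (G : SimpleGraph V) : Prop :=
  G.Connected ∧ G.edgeFinset.card + 1 = Fintype.card V + c

open Classical in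
/-- The number of pendant vertices (vertices of degree `1`). -/
noncomputable def pendantCount {V : Type*} [Fintype V] (G : SimpleGraph V) : ℕ :=
  (Finset.univ.filter fun v : V => G.degree v = 1).card

/-- `G` is a `c`-cyclic graph with `n` vertices and `k` pendant vertices. -/
def InClass (c n k : ℕ) {V : Type*} [Fintype V] (G : SimpleGraph V) : Prop :=
  IsCyclicGraph c G ∧ Fintype.card V = n ∧ pendantCount G = k

/-- `G` is an extremal graph, for the escalating function `f`, among the `c`-cyclic graphs with `n`
vertices and `k` pendant vertices: it is one of them, and it maximizes `M_f` among them. -/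
def IsExtremalGraph {f : ℝ → ℝ → ℝ} (hf : IsEscalating f) (c n k : ℕ)
    {V : Type*} [Fintype V] (G : SimpleGraph V) : Prop :=
  InClass c n k G ∧
    ∀ (W : Type) [Fintype W] (H : SimpleGraph W), InClass c n k H →
      connectivityFunction f hf.symm H ≤ connectivityFunction f hf.symm G

/-- The graph obtained from `H` by attaching, for each `i : Fin k`, a path with `l i` vertices
to the vertex `r`: an end vertex of each path is joined to `r` by an edge. -/
def attachPaths {V : Type*} (H : SimpleGraph V) (r : V) {k : ℕ} (l : Fin k → ℕ) :
    SimpleGraph (V ⊕ (Σ i : Fin k, Fin (l i))) where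
  Adj x y := match x, y with
    | .inl u, .inl v => H.Adj u v
    | .inl u, .inr q => u = r ∧ q.2.val = 0
    | .inr p, .inl v => v = r ∧ p.2.val = 0
    | .inr p, .inr q => p.1 = q.1 ∧ (p.2.val + 1 = q.2.val ∨ q.2.val + 1 = p.2.val)
  symm := ⟨by
    rintro (u | p) (v | q) h
    · exact SimpleGraph.Adj.symm h
    · exact h
    · exact h
    · exact ⟨h.1.symm, h.2.symm⟩⟩
  loopless := ⟨by
    rintro (u | p) h
    · exact H.loopless.irrefl u h
    · obtain ⟨-, h | h⟩ := h <;> omega⟩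

/-- `l` lists the numbers of vertices of `k` (nonempty) paths of almost equal lengths. -/
def AlmostEqualLengths {k : ℕ} (l : Fin k → ℕ) : Prop :=
  (∀ i, 1 ≤ l i) ∧ ∀ i j, |(l i : ℤ) - (l j : ℤ)| ≤ 1

/-- The bicyclic graph `B₂`: two triangles `{0, 1, 2}` and `{0, 3, 4}` sharing the vertex `0`. -/
def bowtie : SimpleGraph (Fin 5) :=
  SimpleGraph.fromEdgeSet {s(0, 1), s(0, 2), s(1, 2), s(0, 3), s(0, 4), s(3, 4)}

/-! Write f(x, y) = f(x, 2) + f(y, 2) - f(2, 2) + I(x, y), where the interaction I vanishes as soon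
as one argument is 2. Summed over the edges, this turns M_f into a constant of the class, a weight
for each non-pendant vertex (depending on its degree and on the number a of its non-pendant
neighbours), and the interactions along edges between non-pendant vertices
(`IsCyclicGraph.connectivityFunction_eq`).

The non-pendant vertices are then merged into one hub, at the level of numbers rather than of
graphs. Degrees 2 + p and 2 + q are replaced by 2 + p + q and 2, the interactions are absorbed by
the weight of the hub, and the parameters a, b are replaced by a + b - 2, a + b - 1 or a + b - 3
(`hubWeight_merge_two`, `hubWeight_merge_one`, `hubWeight_merge_three`). These inequalities combine
the iterated shift condition with convexity, monotonicity and supermodularity. For c ≤ 2 every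
induced subgraph has a vertex of degree at most 2 (at most 1 for trees), so the vertices can be
inserted one at a time with few edges to the hub. The final hub has degree k + 2c.

Two choices of initial parameters bound M_f with final parameter k + 2c (`mergeBound_degree`) or |N|
- 1 (`mergeBound_degreeWithin`), N being the set of non-pendant vertices. In the candidate graph all
non-pendant vertices except possibly the centre have degree 2, so its M_f is the bound evaluated at
the parameter of the centre. Almost equal lengths make that parameter one of the two: either every
path has at least two vertices and the centre has no pendant neighbour, or every path has at most
two and the centre is adjacent to all other non-pendant vertices. -/

namespace IsGoodEscalating

/-! ### Convexity and monotonicity in one variable -/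

variable {f : ℝ → ℝ → ℝ}

theorem convexOn (hf : IsGoodEscalating f) {y : ℝ} (hy : 0 < y) :
    ConvexOn ℝ (Set.Ioi 0) fun t => f t y := by
  refine convexOn_of_deriv2_nonneg (convex_Ioi 0)
    (fun x hx => (hf.differentiable x y hx hy).continuousAt.continuousWithinAt) ?_ ?_ ?_
  · rw [interior_Ioi]
    exact fun x hx => (hf.differentiable x y hx hy).differentiableWithinAt
  · rw [interior_Ioi]
    exact fun x hx => (hf.differentiable_deriv x y hx hy).differentiableWithinAt
  · rw [interior_Ioi]
    exact fun x hx => hf.deriv_deriv_nonneg x y hx hy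

theorem monotoneOn (hf : IsGoodEscalating f) {y : ℝ} (hy : 0 < y) :
    MonotoneOn (fun t => f t y) (Set.Ioi 0) := by
  refine monotoneOn_of_deriv_nonneg (convex_Ioi 0)
    (fun x hx => (hf.differentiable x y hx hy).continuousAt.continuousWithinAt) ?_ ?_
  · rw [interior_Ioi]
    exact fun x hx => (hf.differentiable x y hx hy).differentiableWithinAt
  · rw [interior_Ioi]
    exact fun x hx => (hf.deriv_pos x y hx hy).le

/-- Increments of a convex function grow with the base point. -/
theorem increment_mono (hf : IsGoodEscalating f) {y : ℝ} (hy : 0 < y) {a b p : ℝ}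
    (ha : 0 < a) (hab : a ≤ b) (hp : 0 ≤ p) :
    f (a + p) y - f a y ≤ f (b + p) y - f b y := by
  rcases hp.eq_or_lt with rfl | hp
  · simp
  have hc := hf.convexOn hy
  have hw : 0 < b - a + p := by linarith
  have hba := sub_nonneg.2 hab
  have hbp : b + p ∈ Set.Ioi (0 : ℝ) := by simp only [Set.mem_Ioi]; linarith
  -- Both a + p and b are convex combinations of a and b + p, with the two coefficients exchanged;
  -- adding the two convexity inequalities gives the claim.
  have hsum : (b - a) / (b - a + p) + p / (b - a + p) = 1 := by field_simp
  have h1 := hc.2 (Set.mem_Ioi.2 ha) hbp (div_nonneg hba hw.le) (div_nonneg hp.le hw.le) hsum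
  have h2 := hc.2 (Set.mem_Ioi.2 ha) hbp (div_nonneg hp.le hw.le) (div_nonneg hba hw.le)
    (by rw [add_comm, hsum])
  simp only [smul_eq_mul] at h1 h2
  have e1 : (b - a) / (b - a + p) * a + p / (b - a + p) * (b + p) = a + p := by
    field_simp; ring
  have e2 : p / (b - a + p) * a + (b - a) / (b - a + p) * (b + p) = b := by
    field_simp; ring
  rw [e1] at h1
  rw [e2] at h2
  have : (b - a) / (b - a + p) * f a y + p / (b - a + p) * f (b + p) y
      + (p / (b - a + p) * f a y + (b - a) / (b - a + p) * f (b + p) y)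
      = f a y + f (b + p) y := by
    linear_combination (f a y + f (b + p) y) * hsum
  linarith

end IsGoodEscalating

/-! ### Interactions and hub weights -/

/-- The excess of `f (x, y)` over the value obtained by replacing one argument at a time by `2`. -/
def interaction (f : ℝ → ℝ → ℝ) (x y : ℕ) : ℝ := f x y - f x 2 - f y 2 + f 2 2

/-- The normalized contribution of a vertex of degree `x` with `a` neighbours of degree `2` and
`x - a` pendant neighbours. -/
def hubWeight (f : ℝ → ℝ → ℝ) (x : ℕ) (a : ℝ) : ℝ :=
  a * f x 2 + (x - a) * (f x 1 + (f 2 2 - f 2 1))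

theorem hubWeight_two (f : ℝ → ℝ → ℝ) (a : ℝ) : hubWeight f 2 a = 2 * f 2 2 := by
  simp [hubWeight]; ring

section

variable {f : ℝ → ℝ → ℝ}

theorem IsEscalating.supermodular (hf : IsEscalating f) {x x' y y' : ℝ} (hx : 0 < x)
    (hxx : x ≤ x') (hy : 0 < y) (hyy : y ≤ y') : f x y' + f x' y ≤ f x' y' + f x y := by
  have := hf.ineq x' x y' y hx hxx hy hyy
  rwa [hf.symm y' x] at this

theorem interaction_comm (hf : IsEscalating f) (x y : ℕ) :
    interaction f x y = interaction f y x := by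
  simp only [interaction, hf.symm x y]; ring

theorem interaction_two_left (hf : IsEscalating f) (y : ℕ) : interaction f 2 y = 0 := by
  simp [interaction, hf.symm 2 y]

theorem interaction_two_right (x : ℕ) : interaction f x 2 = 0 := by
  simp [interaction]

theorem interaction_mono_left (hf : IsEscalating f) {x x' y : ℕ} (hx : 0 < x) (hxx : x ≤ x')
    (hy : 2 ≤ y) : interaction f x y ≤ interaction f x' y := by
  have := hf.supermodular (x := x) (x' := x') (y := 2) (y' := y) (by exact_mod_cast hx)
    (by exact_mod_cast hxx) (by norm_num) (by exact_mod_cast hy)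
  simp only [interaction]; linarith

theorem interaction_nonneg (hf : IsEscalating f) {x y : ℕ} (hx : 2 ≤ x) (hy : 2 ≤ y) :
    0 ≤ interaction f x y := by
  have := interaction_mono_left hf (x := 2) (x' := x) (by norm_num) hx hy
  rwa [interaction_two_left hf] at this

/-- The coefficient of a is f(x, 2) - f(x, 1) - (f(2, 2) - f(2, 1)), which is nonnegative by
supermodularity. -/
theorem hubWeight_mono (hf : IsEscalating f) {x : ℕ} (hx : 2 ≤ x) {a b : ℝ} (hab : a ≤ b) :
    hubWeight f x a ≤ hubWeight f x b := by
  have := hf.supermodular (x := 2) (x' := x) (y := 1) (y' := 2) (by norm_num)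
    (by exact_mod_cast hx) (by norm_num) (by norm_num)
  have h : 0 ≤ (b - a) * (f x 2 - (f x 1 + (f 2 2 - f 2 1))) :=
    mul_nonneg (by linarith) (by linarith)
  simp only [hubWeight]; nlinarith

/-! ### Numerical inequalities for merging two hubs -/

/-- Moving all but two neighbours of a vertex to an adjacent vertex of no smaller degree. -/
theorem IsGoodEscalating.le_sum_increments (hf : IsGoodEscalating f) (q : ℕ) :
    ∀ p : ℕ, q ≤ p → f (2 + p) (2 + q) ≤ f (2 + p + q) 2 +
      ∑ i ∈ Finset.range q, (f (3 + i + p) 1 - f (3 + i) 1) := by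
  induction q with
  | zero => intro p _; simp
  | succ q ih =>
    intro p hp
    have h1 := ih (p + 1) (by omega)
    have hp' : (q : ℝ) + 1 ≤ p := by exact_mod_cast hp
    have hq : (0 : ℝ) ≤ q := by positivity
    -- One unit of degree moves from 3 + q to 2 + p, with a pendant vertex as the third argument.
    -- This produces the first positive and the last negative term of the sum; the remaining terms
    -- come from the induction hypothesis at p + 1.
    have h2 := hf.shift (2 + p) (3 + q) 1 (by linarith) (by linarith) le_rfl
    rw [Finset.sum_sub_distrib] at h1 ⊢
    rw [Finset.sum_range_succ', Finset.sum_range_succ]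
    push_cast at h1 ⊢
    rw [hf.symm 1] at h2
    have e1 : (2 : ℝ) + (p + 1) = 2 + p + 1 := by ring
    have e2 : (3 : ℝ) + q - 1 = 2 + q := by ring
    have e3 : (2 : ℝ) + (q + 1) = 3 + q := by ring
    have e4 : (2 : ℝ) + p + 1 + q = 2 + p + (q + 1) := by ring
    have e5 : (3 : ℝ) + 0 + p = 2 + p + 1 := by ring
    rw [e1, e4] at h1
    rw [e2] at h2
    rw [e3, e5]
    have e6 : ∀ i : ℝ, (3 : ℝ) + i + (p + 1) = 3 + (i + 1) + p := fun i => by ring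
    simp only [e6] at h1
    linarith

/-- The same B has to be charged to the pendant neighbours of either hub, whence two bounds. For the
first, each summand splits into p unit increments, all dominated by the one starting at 2 + p + i,
and these telescope over i. For the second, each of the q summands is an increment of length p from
a base at most 2 + q. -/
theorem IsGoodEscalating.exists_interaction_le_aux (hf : IsGoodEscalating f) {p q : ℕ}
    (hpq : q ≤ p) :
    ∃ B : ℝ, f (2 + p) (2 + q) ≤ f (2 + p + q) 2 + B ∧
      B ≤ p * (f (2 + p + q) 1 - f (2 + p) 1) ∧ B ≤ q * (f (2 + p + q) 1 - f (2 + q) 1) := by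
  refine ⟨_, hf.le_sum_increments q p hpq, ?_, ?_⟩
  · have h : ∀ i ∈ Finset.range q, f (3 + i + p) 1 - f (3 + i) 1 ≤
        p * (f (2 + p + (i + 1 : ℕ)) 1 - f (2 + p + i) 1) := by
      intro i _
      have key : ∀ s : ℕ, s ≤ p → f (3 + i + s) 1 - f (3 + i) 1 ≤
          s * (f (2 + p + (i + 1 : ℕ)) 1 - f (2 + p + i) 1) := by
        intro s
        induction s with
        | zero => intro _; simp
        | succ s ih =>
          intro hs
          have hs' : (s : ℝ) + 1 ≤ p := by exact_mod_cast hs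
          have := hf.increment_mono (y := 1) one_pos (a := 3 + i + s) (b := 2 + p + i) (p := 1)
            (by positivity) (by linarith) zero_le_one
          have h0 := ih (by omega)
          push_cast at h0 ⊢
          rw [show (3 : ℝ) + i + (s + 1) = 3 + i + s + 1 by ring]
          rw [show (2 : ℝ) + p + (i + 1) = 2 + p + i + 1 by ring] at h0 ⊢
          linarith
      exact key p le_rfl
    refine (Finset.sum_le_sum h).trans ?_
    rw [← Finset.mul_sum, Finset.sum_range_sub (fun i : ℕ => f (2 + p + i) 1)]
    simp
  · have h : ∀ i ∈ Finset.range q, f (3 + i + p) 1 - f (3 + i) 1 ≤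
        f (2 + p + q) 1 - f (2 + q) 1 := by
      intro i hi
      have hi' : (i : ℝ) + 1 ≤ q := by exact_mod_cast Finset.mem_range.1 hi
      have := hf.increment_mono (y := 1) one_pos (a := 3 + i) (b := 2 + q) (p := p)
        (by positivity) (by linarith) (by positivity)
      rwa [show (2 : ℝ) + q + p = 2 + p + q by ring] at this
    refine (Finset.sum_le_sum h).trans ?_
    rw [Finset.sum_const, Finset.card_range, nsmul_eq_mul]

theorem IsGoodEscalating.exists_interaction_le (hf : IsGoodEscalating f) (p q : ℕ) :
    ∃ B : ℝ, f (2 + p) (2 + q) ≤ f (2 + p + q) 2 + B ∧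
      B ≤ p * (f (2 + p + q) 1 - f (2 + p) 1) ∧ B ≤ q * (f (2 + p + q) 1 - f (2 + q) 1) := by
  rcases le_total q p with h | h
  · exact hf.exists_interaction_le_aux h
  · obtain ⟨B, h1, h2, h3⟩ := hf.exists_interaction_le_aux h
    rw [show (2 : ℝ) + q + p = 2 + p + q by ring] at h1 h2 h3
    exact ⟨B, by rwa [hf.symm], h3, h2⟩

/-- The numerical facts behind merging two hubs of degrees `2 + p` and `2 + q`. -/
theorem IsGoodEscalating.merge_facts (hf : IsGoodEscalating f) (p q : ℕ) :
    f (2 + p) 1 - f 2 1 ≤ f (2 + p + q) 1 - f (2 + q) 1 ∧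
    f (2 + p) 2 - f 2 2 ≤ f (2 + p + q) 2 - f (2 + q) 2 ∧
    f (2 + p + q) 1 - f (2 + p) 1 ≤ f (2 + p + q) 2 - f (2 + p) 2 ∧
    f (2 + p + q) 1 - f (2 + q) 1 ≤ f (2 + p + q) 2 - f (2 + q) 2 ∧
    f 2 1 ≤ f (2 + p) 1 ∧ f 2 1 ≤ f (2 + q) 1 := by
  have hp : (0 : ℝ) ≤ p := by positivity
  have hq : (0 : ℝ) ≤ q := by positivity
  have e : (2 : ℝ) + q + p = 2 + p + q := by ring
  refine ⟨?_, ?_, ?_, ?_, ?_, ?_⟩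
  · have := hf.increment_mono (y := 1) one_pos (a := 2) (b := 2 + q) (p := p) (by norm_num)
      (by linarith) hp
    rwa [e] at this
  · have := hf.increment_mono (y := 2) two_pos (a := 2) (b := 2 + q) (p := p) (by norm_num)
      (by linarith) hp
    rwa [e] at this
  · have := hf.supermodular (x := 2 + p) (x' := 2 + p + q) (y := 1) (y' := 2) (by linarith)
      (by linarith) (by norm_num) (by norm_num)
    linarith
  · have := hf.supermodular (x := 2 + q) (x' := 2 + p + q) (y := 1) (y' := 2) (by linarith)
      (by linarith) (by norm_num) (by norm_num)
    linarith
  · exact hf.monotoneOn one_pos (by simp) (by simp only [Set.mem_Ioi]; linarith) (by linarith)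
  · exact hf.monotoneOn one_pos (by simp) (by simp only [Set.mem_Ioi]; linarith) (by linarith)

/-- The two copies of B are charged to the two hubs, one to each; supermodularity handles the
excesses of a and b over 2. -/
theorem hubWeight_merge_two (hf : IsGoodEscalating f) {p q : ℕ} {a b : ℝ} (ha : 2 ≤ a)
    (hb : 2 ≤ b) :
    2 * interaction f (2 + p) (2 + q) + hubWeight f (2 + p) a + hubWeight f (2 + q) b ≤
      hubWeight f (2 + p + q) (a + b - 2) + 2 * f 2 2 := by
  obtain ⟨B, h1, h2, h3⟩ := hf.exists_interaction_le p q
  obtain ⟨f1, f2, f3, f4, f5, f6⟩ := hf.merge_facts p q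
  simp only [interaction, hubWeight]
  push_cast
  have m1 := mul_le_mul_of_nonneg_left f3 (sub_nonneg.2 ha)
  have m2 := mul_le_mul_of_nonneg_left f4 (sub_nonneg.2 hb)
  linear_combination 2 * h1 + h2 + h3 + m1 + m2

theorem hubWeight_merge_one (hf : IsGoodEscalating f) {p q : ℕ} {a b : ℝ} (ha : 1 ≤ a)
    (hb : 1 ≤ b) :
    interaction f (2 + p) (2 + q) + hubWeight f (2 + p) a + hubWeight f (2 + q) b ≤
      hubWeight f (2 + p + q) (a + b - 1) + 2 * f 2 2 := by
  obtain ⟨B, h1, h2, h3⟩ := hf.exists_interaction_le p q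
  obtain ⟨f1, f2, f3, f4, f5, f6⟩ := hf.merge_facts p q
  simp only [interaction, hubWeight]
  push_cast
  have m1 := mul_le_mul_of_nonneg_left f3 (sub_nonneg.2 ha)
  have m2 := mul_le_mul_of_nonneg_left f4 (sub_nonneg.2 hb)
  have m3 : 0 ≤ (p : ℝ) * (f (2 + p + q) 1 - f (2 + p) 1) :=
    mul_nonneg (by positivity) (by linarith)
  linear_combination h1 + h3 + m1 + m2 + f1 + m3

/-- With a single interaction to absorb, larger parameters leave room to lose 3 instead of 1. This
sharper loss is needed only for four vertices spanning five edges. -/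
theorem hubWeight_merge_three (hf : IsGoodEscalating f) {p q : ℕ} (hq : 1 ≤ q) {a b : ℝ}
    (ha : 3 ≤ a) (hb : 3 ≤ b) :
    interaction f (2 + p) (2 + q) + hubWeight f (2 + p) a + hubWeight f (2 + q) b ≤
      hubWeight f (2 + p + q) (a + b - 3) + 2 * f 2 2 := by
  obtain ⟨B, h1, h2, h3⟩ := hf.exists_interaction_le p q
  obtain ⟨f1, f2, f3, f4, f5, f6⟩ := hf.merge_facts p q
  simp only [interaction, hubWeight]
  push_cast
  have m1 := mul_le_mul_of_nonneg_left f3 (sub_nonneg.2 ha)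
  have m2 := mul_le_mul_of_nonneg_left f4 (sub_nonneg.2 hb)
  have hq' : (1 : ℝ) ≤ q := by exact_mod_cast hq
  have m3 : 0 ≤ ((q : ℝ) - 1) * (f (2 + p + q) 1 - f (2 + q) 1) :=
    mul_nonneg (by linarith) (by linarith)
  linear_combination h1 + h2 + m1 + m2 + m3 + 2 * f2 + f5

end

/-! ### Counting edges in induced subgraphs -/

section

open Classical

variable {V : Type*}

/-- The number of neighbours of `v` in `S`. -/
noncomputable def degreeWithin (G : SimpleGraph V) (S : Finset V) (v : V) : ℕ :=
  (S.filter (G.Adj v)).card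

/-- Twice the number of edges with both ends in `S`. -/
noncomputable def innerDegreeSum (G : SimpleGraph V) (S : Finset V) : ℕ :=
  ∑ v ∈ S, degreeWithin G S v

theorem degreeWithin_mono (G : SimpleGraph V) {S T : Finset V} (h : S ⊆ T) (v : V) :
    degreeWithin G S v ≤ degreeWithin G T v :=
  Finset.card_le_card (Finset.filter_subset_filter _ h)

theorem sum_filter_adj_comm {M : Type*} [AddCommMonoid M] (G : SimpleGraph V) (S T : Finset V)
    (g : V → V → M) :
    ∑ u ∈ S, ∑ v ∈ T.filter (G.Adj u), g u v = ∑ v ∈ T, ∑ u ∈ S.filter (G.Adj v), g u v := by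
  simp only [Finset.sum_filter]
  rw [Finset.sum_comm]
  simp only [G.adj_comm]

theorem sum_degreeWithin_comm (G : SimpleGraph V) (S T : Finset V) :
    ∑ u ∈ S, degreeWithin G T u = ∑ v ∈ T, degreeWithin G S v := by
  simp only [degreeWithin, Finset.card_eq_sum_ones]
  exact sum_filter_adj_comm G S T fun _ _ => 1

theorem degreeWithin_union (G : SimpleGraph V) {S T : Finset V} (h : Disjoint S T) (v : V) :
    degreeWithin G (S ∪ T) v = degreeWithin G S v + degreeWithin G T v := by
  rw [degreeWithin, Finset.filter_union,
    Finset.card_union_of_disjoint (Finset.disjoint_filter_filter h), degreeWithin, degreeWithin]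

theorem degreeWithin_lt_card (G : SimpleGraph V) {S : Finset V} {v : V} (hv : v ∈ S) :
    degreeWithin G S v < S.card := by
  refine Finset.card_lt_card ⟨Finset.filter_subset _ _, fun h => ?_⟩
  simpa using h hv

theorem degreeWithin_le_two (G : SimpleGraph V) {S : Finset V} {v a b : V}
    (h : ∀ u ∈ S, G.Adj v u → u = a ∨ u = b) : degreeWithin G S v ≤ 2 := by
  refine (Finset.card_le_card (t := {a, b}) fun u hu => ?_).trans Finset.card_le_two
  rw [Finset.mem_filter] at hu
  simpa using h u hu.1 hu.2

/-- Inserting a vertex into the index set of a symmetric sum over adjacent pairs. -/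
theorem sum_filter_adj_insert (G : SimpleGraph V) {S : Finset V} {v : V} (hv : v ∉ S)
    (g : V → V → ℝ) (hg : ∀ u w, g u w = g w u) :
    ∑ u ∈ insert v S, ∑ w ∈ (insert v S).filter (G.Adj u), g u w =
      ∑ u ∈ S, ∑ w ∈ S.filter (G.Adj u), g u w + 2 * ∑ u ∈ S.filter (G.Adj v), g u v := by
  have h1 : ∀ u, ∑ w ∈ (insert v S).filter (G.Adj u), g u w =
      (if G.Adj u v then g u v else 0) + ∑ w ∈ S.filter (G.Adj u), g u w := by
    intro u
    rw [Finset.filter_insert]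
    split_ifs with h
    · rw [Finset.sum_insert (by simp [hv])]
    · simp
  simp only [h1, Finset.sum_insert hv, Finset.sum_add_distrib, G.irrefl, if_false]
  simp only [G.adj_comm _ v, ← Finset.sum_filter, hg v]
  ring

theorem innerDegreeSum_insert (G : SimpleGraph V) {S : Finset V} {v : V} (hv : v ∉ S) :
    innerDegreeSum G (insert v S) = innerDegreeSum G S + 2 * degreeWithin G S v := by
  have := sum_filter_adj_insert G hv (fun _ _ => 1) fun _ _ => rfl
  simp only [innerDegreeSum, degreeWithin]
  have h : ((∑ u ∈ insert v S, ((insert v S).filter (G.Adj u)).card : ℕ) : ℝ) =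
      ((∑ u ∈ S, (S.filter (G.Adj u)).card + 2 * (S.filter (G.Adj v)).card : ℕ) : ℝ) := by
    push_cast
    simpa using this
  exact_mod_cast h

variable [Fintype V]

theorem degreeWithin_univ (G : SimpleGraph V) (v : V) :
    degreeWithin G Finset.univ v = G.degree v := by
  rw [degreeWithin, ← SimpleGraph.card_neighborFinset_eq_degree,
    SimpleGraph.neighborFinset_eq_filter]

theorem innerDegreeSum_univ (G : SimpleGraph V) :
    innerDegreeSum G Finset.univ = 2 * G.edgeFinset.card := by
  simp only [innerDegreeSum, degreeWithin_univ, SimpleGraph.sum_degrees_eq_twice_card_edges]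

theorem SimpleGraph.Connected.exists_adj_of_ne_univ {G : SimpleGraph V} (hG : G.Connected)
    {S : Finset V} (hS : S.Nonempty) (hSu : S ≠ Finset.univ) :
    ∃ v, v ∉ S ∧ ∃ u ∈ S, G.Adj v u := by
  obtain ⟨a, ha⟩ := hS
  obtain ⟨b, hb⟩ : ∃ b, b ∉ S := by
    by_contra! h
    exact hSu (Finset.eq_univ_iff_forall.2 h)
  obtain ⟨p⟩ := hG.preconnected a b
  obtain ⟨d, -, h1, h2⟩ := p.exists_boundary_dart (S : Set V) ha hb
  exact ⟨d.snd, h2, d.fst, h1, d.adj.symm⟩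

/-- Connectedness lets S grow to the whole vertex set by adding one vertex at a time, each bringing
at least one new edge. Hence the excess of edges over vertices of an induced subgraph is at most
that of G. -/
theorem SimpleGraph.Connected.innerDegreeSum_le {G : SimpleGraph V} (hG : G.Connected)
    {S : Finset V} (hS : S.Nonempty) :
    innerDegreeSum G S + 2 * Fintype.card V ≤ 2 * G.edgeFinset.card + 2 * S.card := by
  induction hm : Fintype.card V - S.card generalizing S with
  | zero =>
    have : S = Finset.univ := by
      rw [← Finset.card_eq_iff_eq_univ]
      have := S.card_le_univ
      omega
    rw [this, innerDegreeSum_univ, Finset.card_univ]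
  | succ m ih =>
    have hSu : S ≠ Finset.univ := by
      rintro rfl
      simp at hm
    obtain ⟨v, hv, u, hu, hvu⟩ := hG.exists_adj_of_ne_univ hS hSu
    have h1 := ih (S := insert v S) (Finset.insert_nonempty _ _)
      (by rw [Finset.card_insert_of_notMem hv]; omega)
    rw [innerDegreeSum_insert G hv, Finset.card_insert_of_notMem hv] at h1
    have : 0 < degreeWithin G S v := Finset.card_pos.2 ⟨u, by simp [hu, hvu]⟩
    omega

theorem IsCyclicGraph.innerDegreeSum_le {c : ℕ} {G : SimpleGraph V} (hG : IsCyclicGraph c G)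
    {S : Finset V} (hS : S.Nonempty) : innerDegreeSum G S + 2 ≤ 2 * (S.card + c) := by
  have := hG.1.innerDegreeSum_le hS
  have := hG.2
  omega

/-- Induced subgraphs of a graph with small cyclomatic number are degenerate. -/
theorem IsCyclicGraph.exists_degreeWithin_le {c : ℕ} {G : SimpleGraph V}
    (hG : IsCyclicGraph c G) (hc : c ≤ 2) {S : Finset V} (hS : S.Nonempty) :
    ∃ v ∈ S, degreeWithin G S v ≤ min (c + 1) 2 := by
  by_contra! h
  have h1 : ∑ v ∈ S, (min (c + 1) 2 + 1) ≤ innerDegreeSum G S := Finset.sum_le_sum h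
  have h2 := hG.innerDegreeSum_le hS
  rw [Finset.sum_const, smul_eq_mul] at h1
  obtain ⟨v, hv⟩ := hS
  have h3 := h v hv
  have h4 := degreeWithin_lt_card G hv
  -- For c = 0 and c = 1 the edge count alone is contradictory. For c = 2 it leaves at most two
  -- vertices, too few for an inner degree of 3.
  interval_cases c <;> simp at h1 h2 h3 <;> omega

/-! ### Merging hubs -/

/-- The sum of the interactions of the adjacent ordered pairs in `S`. -/
noncomputable def pairInteraction (f : ℝ → ℝ → ℝ) (G : SimpleGraph V) (S : Finset V) : ℝ :=
  ∑ u ∈ S, ∑ v ∈ S.filter (G.Adj u), interaction f (G.degree u) (G.degree v)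

/-- The degree of the hub into which the vertices of `S` are merged. -/
noncomputable def hubDegree (G : SimpleGraph V) (S : Finset V) : ℕ :=
  2 + ∑ v ∈ S, (G.degree v - 2)

/-- Merging the vertices of `S`, which have the weights `a`, into one hub of weight `α` does not
decrease the connectivity function. -/
def MergeBound (f : ℝ → ℝ → ℝ) (G : SimpleGraph V) (a : V → ℝ) (S : Finset V) (α : ℝ) : Prop :=
  ∑ v ∈ S, (hubWeight f (G.degree v) (a v) - 2 * f 2 2) + pairInteraction f G S / 2 ≤
    hubWeight f (hubDegree G S) α - 2 * f 2 2

section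

variable {f : ℝ → ℝ → ℝ} {G : SimpleGraph V} {a : V → ℝ} {S : Finset V} {α : ℝ} {v : V}

theorem mergeBound_empty (f : ℝ → ℝ → ℝ) (G : SimpleGraph V) (a : V → ℝ) (α : ℝ) :
    MergeBound f G a ∅ α := by
  simp [MergeBound, pairInteraction, hubDegree, hubWeight_two]

theorem mergeBound_singleton (f : ℝ → ℝ → ℝ) (a : V → ℝ) (hv : 2 ≤ G.degree v) :
    MergeBound f G a {v} (a v) := by
  have h : 2 + (G.degree v - 2) = G.degree v := by omega
  simp [MergeBound, pairInteraction, hubDegree, h, Finset.filter_singleton]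

theorem hubDegree_insert (hv : v ∉ S) :
    hubDegree G (insert v S) = hubDegree G S + (G.degree v - 2) := by
  rw [hubDegree, hubDegree, Finset.sum_insert hv]; omega

theorem degree_le_hubDegree {u : V} (hu : u ∈ S) : G.degree u ≤ hubDegree G S := by
  have := Finset.single_le_sum (f := fun v => G.degree v - 2) (fun _ _ => Nat.zero_le _) hu
  rw [hubDegree]; omega

theorem MergeBound.mono (hf : IsEscalating f) (h : MergeBound f G a S α) {β : ℝ}
    (hαβ : α ≤ β) : MergeBound f G a S β :=
  h.trans (sub_le_sub_right (hubWeight_mono hf (Nat.le_add_right _ _) hαβ) _)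

/-- Degrees in S do not exceed the hub degree, so by monotonicity each of the at most e interactions
of v with S is bounded by its interaction with the hub. This reduces the insertion to a two-hub
inequality. -/
theorem MergeBound.insert_of_le (hf : IsGoodEscalating f) (h : MergeBound f G a S α)
    (hS : ∀ u ∈ S, 2 ≤ G.degree u) (hv : v ∉ S) (hdv : 2 ≤ G.degree v) {e : ℕ}
    (he : degreeWithin G S v ≤ e) {β : ℝ}
    (hm : e * interaction f (hubDegree G S) (G.degree v) + hubWeight f (hubDegree G S) α +
      hubWeight f (G.degree v) (a v) ≤ hubWeight f (hubDegree G (insert v S)) β + 2 * f 2 2) :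
    MergeBound f G a (insert v S) β := by
  have h1 : ∑ u ∈ S.filter (G.Adj v), interaction f (G.degree u) (G.degree v) ≤
      degreeWithin G S v * interaction f (hubDegree G S) (G.degree v) := by
    rw [degreeWithin, ← nsmul_eq_mul, ← Finset.sum_const]
    refine Finset.sum_le_sum fun u hu => ?_
    have hu := (Finset.mem_filter.1 hu).1
    exact interaction_mono_left hf.toIsEscalating (by have := hS u hu; omega)
      (degree_le_hubDegree hu) hdv
  have h0 : 0 ≤ interaction f (hubDegree G S) (G.degree v) :=
    interaction_nonneg hf.toIsEscalating (by rw [hubDegree]; omega) hdv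
  have h2 := mul_le_mul_of_nonneg_right (Nat.cast_le (α := ℝ).2 he) h0
  have h3 : pairInteraction f G (insert v S) = _ := sum_filter_adj_insert G hv
    (fun u w => interaction f (G.degree u) (G.degree w))
    fun u w => interaction_comm hf.toIsEscalating _ _
  unfold MergeBound at h ⊢
  rw [h3, Finset.sum_insert hv]
  unfold pairInteraction at h
  linarith

theorem MergeBound.insert_two (hf : IsGoodEscalating f) (h : MergeBound f G a S α)
    (hS : ∀ u ∈ S, 2 ≤ G.degree u) (hv : v ∉ S) (hdv : 2 ≤ G.degree v)
    (he : degreeWithin G S v ≤ 2) (hα : 2 ≤ α) (hav : 2 ≤ a v) :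
    MergeBound f G a (insert v S) (α + a v - 2) := by
  refine h.insert_of_le hf hS hv hdv he ?_
  obtain ⟨q, hq⟩ := Nat.exists_eq_add_of_le hdv
  rw [hubDegree_insert hv, hubDegree, hq, Nat.add_sub_cancel_left]
  exact hubWeight_merge_two hf hα hav

theorem MergeBound.insert_one (hf : IsGoodEscalating f) (h : MergeBound f G a S α)
    (hS : ∀ u ∈ S, 2 ≤ G.degree u) (hv : v ∉ S) (hdv : 2 ≤ G.degree v)
    (he : degreeWithin G S v ≤ 1) (hα : 1 ≤ α) (hav : 1 ≤ a v) :
    MergeBound f G a (insert v S) (α + a v - 1) := by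
  refine h.insert_of_le hf hS hv hdv he ?_
  obtain ⟨q, hq⟩ := Nat.exists_eq_add_of_le hdv
  rw [hubDegree_insert hv, hubDegree, hq, Nat.add_sub_cancel_left, Nat.cast_one, one_mul]
  exact hubWeight_merge_one hf hα hav

theorem MergeBound.insert_three (hf : IsGoodEscalating f) (h : MergeBound f G a S α)
    (hS : ∀ u ∈ S, 2 ≤ G.degree u) (hv : v ∉ S) (hdv : 3 ≤ G.degree v)
    (he : degreeWithin G S v ≤ 1) (hα : 3 ≤ α) (hav : 3 ≤ a v) :
    MergeBound f G a (insert v S) (α + a v - 3) := by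
  refine h.insert_of_le hf hS hv (by omega) he ?_
  obtain ⟨q, hq⟩ := Nat.exists_eq_add_of_le (show 2 ≤ G.degree v by omega)
  rw [hubDegree_insert hv, hubDegree, hq, Nat.add_sub_cancel_left, Nat.cast_one, one_mul]
  exact hubWeight_merge_three hf (by omega) hα hav

/-- By degeneracy, a vertex with at most two neighbours in S can be removed, the rest merged, and
the vertex inserted last at a loss of 2. -/
theorem IsCyclicGraph.mergeBound_of_two_le (hf : IsGoodEscalating f) {c : ℕ} (hc : c ≤ 2)
    (hG : IsCyclicGraph c G) (S : Finset V) (hS : ∀ u ∈ S, 2 ≤ G.degree u)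
    (ha : ∀ u ∈ S, 2 ≤ a u) : MergeBound f G a S (2 + ∑ u ∈ S, (a u - 2)) := by
  induction hm : S.card generalizing S with
  | zero =>
    rw [Finset.card_eq_zero.1 hm]
    exact mergeBound_empty ..
  | succ m ih =>
    have hne : S.Nonempty := Finset.card_pos.1 (by omega)
    obtain ⟨v, hv, hdeg⟩ := hG.exists_degreeWithin_le hc hne
    have hle := degreeWithin_mono G (S.erase_subset v) v
    have h1 := ih (S.erase v) (fun u hu => hS u (Finset.mem_of_mem_erase hu))
      (fun u hu => ha u (Finset.mem_of_mem_erase hu)) (by rw [Finset.card_erase_of_mem hv]; omega)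
    have h0 : 0 ≤ ∑ u ∈ S.erase v, (a u - 2) :=
      Finset.sum_nonneg fun u hu => sub_nonneg.2 (ha u (Finset.mem_of_mem_erase hu))
    have h2 := h1.insert_two hf (fun u hu => hS u (Finset.mem_of_mem_erase hu))
      (Finset.notMem_erase v S) (hS v hv) (by omega) (by linarith) (ha v hv)
    rw [Finset.insert_erase hv] at h2
    rw [← Finset.add_sum_erase S _ hv]
    convert h2 using 1
    ring

theorem IsCyclicGraph.mergeBound_tree (hf : IsGoodEscalating f)
    (hG : IsCyclicGraph 0 G) (S : Finset V) (hS : ∀ u ∈ S, 2 ≤ G.degree u)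
    (ha : ∀ u ∈ S, 1 ≤ a u) : MergeBound f G a S (1 + ∑ u ∈ S, (a u - 1)) := by
  induction hm : S.card generalizing S with
  | zero =>
    rw [Finset.card_eq_zero.1 hm]
    exact mergeBound_empty ..
  | succ m ih =>
    have hne : S.Nonempty := Finset.card_pos.1 (by omega)
    obtain ⟨v, hv, hdeg⟩ := hG.exists_degreeWithin_le (by norm_num) hne
    have hle := degreeWithin_mono G (S.erase_subset v) v
    have h1 := ih (S.erase v) (fun u hu => hS u (Finset.mem_of_mem_erase hu))
      (fun u hu => ha u (Finset.mem_of_mem_erase hu)) (by rw [Finset.card_erase_of_mem hv]; omega)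
    have h0 : 0 ≤ ∑ u ∈ S.erase v, (a u - 1) :=
      Finset.sum_nonneg fun u hu => sub_nonneg.2 (ha u (Finset.mem_of_mem_erase hu))
    have h2 := h1.insert_one hf (fun u hu => hS u (Finset.mem_of_mem_erase hu))
      (Finset.notMem_erase v S) (hS v hv) (by omega) (by linarith) (ha v hv)
    rw [Finset.insert_erase hv] at h2
    rw [← Finset.add_sum_erase S _ hv]
    convert h2 using 1
    ring

/-- Vertices of weight one and with at most one neighbour inside can be merged for free. -/
theorem MergeBound.union_of_one (hf : IsGoodEscalating f) (h : MergeBound f G a S α)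
    (hα : 1 ≤ α) (T : Finset V) (hST : Disjoint S T) (hd : ∀ u ∈ S ∪ T, 2 ≤ G.degree u)
    (ha : ∀ u ∈ T, a u = 1) (he : ∀ u ∈ T, degreeWithin G (S ∪ T) u ≤ 1) :
    MergeBound f G a (S ∪ T) α := by
  induction T using Finset.induction_on with
  | empty => simpa using h
  | insert v T hv ih =>
    rw [Finset.disjoint_insert_right] at hST
    rw [Finset.union_insert] at hd he ⊢
    have hv' : v ∉ S ∪ T := by simp [hv, hST.1]
    have hle : ∀ u, degreeWithin G (S ∪ T) u ≤ degreeWithin G (insert v (S ∪ T)) u :=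
      degreeWithin_mono G (Finset.subset_insert _ _)
    have h1 := ih hST.2 (fun u hu => hd u (Finset.mem_insert_of_mem hu))
      (fun u hu => ha u (Finset.mem_insert_of_mem hu))
      (fun u hu => (hle u).trans (he u (Finset.mem_insert_of_mem hu)))
    have hav : a v = 1 := ha v (Finset.mem_insert_self _ _)
    have h2 := h1.insert_one hf (fun u hu => hd u (Finset.mem_insert_of_mem hu)) hv'
      (hd v (Finset.mem_insert_self _ _)) ((hle v).trans (he v (Finset.mem_insert_self _ _))) hα
      hav.ge
    rwa [hav, add_sub_cancel_right] at h2

end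

end

/-! ### Expansion of the connectivity function over non-pendant vertices -/

section

open Classical

variable {V : Type*} [Fintype V]

/-- The vertices of degree at least two. -/
noncomputable def nonpendants (G : SimpleGraph V) : Finset V :=
  Finset.univ.filter fun v => 2 ≤ G.degree v

/-- The vertices of degree one. -/
noncomputable def pendants (G : SimpleGraph V) : Finset V :=
  Finset.univ.filter fun v => G.degree v = 1

theorem two_mul_connectivityFunction (f : ℝ → ℝ → ℝ) (hf : ∀ x y : ℝ, f x y = f y x)
    (G : SimpleGraph V) :
    2 * connectivityFunction f hf G =
      ∑ u, ∑ v ∈ Finset.univ.filter (G.Adj u), f (G.degree u) (G.degree v) := by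
  have h1 : ∑ u, ∑ v ∈ Finset.univ.filter (G.Adj u), f (G.degree u) (G.degree v) =
      ∑ d : G.Dart, f (G.degree d.fst) (G.degree d.snd) := by
    simp only [Finset.sum_filter]
    rw [← Fintype.sum_prod_type' (f := fun u v => if G.Adj u v then
      f (G.degree u) (G.degree v) else 0), ← Finset.sum_filter]
    refine Finset.sum_bij' (fun p hp => ⟨p, (Finset.mem_filter.1 hp).2⟩) (fun d _ => d.toProd)
      ?_ ?_ ?_ ?_ ?_
    · simp
    · intro d _
      simp
    · simp
    · simp
    · simp
  rw [h1, ← Finset.sum_fiberwise_of_maps_to (s := Finset.univ) (t := G.edgeFinset)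
    (g := SimpleGraph.Dart.edge) (fun d _ => by simp), connectivityFunction,
    Finset.mul_sum]
  refine Finset.sum_congr rfl fun e he => ?_
  rw [Finset.sum_congr rfl (g := fun _ => Sym2.lift ⟨fun u v : V =>
    f (G.degree u : ℝ) (G.degree v : ℝ), fun _ _ => hf _ _⟩ e), Finset.sum_const,
    G.dart_edge_fiber_card e (by simpa using he), nsmul_eq_mul, Nat.cast_two]
  intro d hd
  rw [← (Finset.mem_filter.1 hd).2]
  rfl

theorem disjoint_nonpendants_pendants (G : SimpleGraph V) :
    Disjoint (nonpendants G) (pendants G) := by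
  rw [nonpendants, pendants, Finset.disjoint_filter]
  intro v _ h; omega

namespace IsCyclicGraph

variable {c : ℕ} {G : SimpleGraph V}

theorem degree_pos (hG : IsCyclicGraph c G) (h3 : 3 ≤ Fintype.card V) (v : V) :
    1 ≤ G.degree v := by
  obtain ⟨w, -, u, hu, hwu⟩ := hG.1.exists_adj_of_ne_univ (Finset.singleton_nonempty v)
    fun h => by have := congrArg Finset.card h; simp at this; omega
  rw [Finset.mem_singleton.1 hu] at hwu
  exact (G.degree_pos_iff_exists_adj v).2 ⟨w, hwu.symm⟩

theorem nonpendants_union_pendants (hG : IsCyclicGraph c G) (h3 : 3 ≤ Fintype.card V) :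
    nonpendants G ∪ pendants G = Finset.univ := by
  ext v
  have := hG.degree_pos h3 v
  simp only [nonpendants, pendants, Finset.mem_union, Finset.mem_filter, Finset.mem_univ, true_and,
    iff_true]
  omega

/-- Otherwise u and v would form a component, but connectedness supplies a third vertex adjacent to
one of them. -/
theorem not_adj_of_pendants (hG : IsCyclicGraph c G) (h3 : 3 ≤ Fintype.card V) {u v : V}
    (hu : u ∈ pendants G) (hv : v ∈ pendants G) : ¬ G.Adj u v := by
  intro h
  obtain ⟨w, hw, x, hx, hwx⟩ := hG.1.exists_adj_of_ne_univ (Finset.insert_nonempty u {v})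
    fun h => by
      have h1 := congrArg Finset.card h
      have h2 := Finset.card_le_two (a := u) (b := v)
      rw [Finset.card_univ] at h1
      omega
  simp only [Finset.mem_insert, Finset.mem_singleton, not_or] at hw hx
  have key : ∀ a b : V, a ∈ pendants G → G.Adj a b → G.Adj w a → w = b := by
    intro a b ha hab hwa
    have h1 := (Finset.mem_filter.1 ha).2
    rw [← G.card_neighborFinset_eq_degree, Finset.card_eq_one] at h1
    obtain ⟨z, hz⟩ := h1
    have hb : b ∈ G.neighborFinset a := by simpa using hab
    have hw : w ∈ G.neighborFinset a := by simpa using hwa.symm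
    rw [hz, Finset.mem_singleton] at hb hw
    rw [hb, hw]
  rcases hx with rfl | rfl
  · exact hw.2 (key x v hu h hwx)
  · exact hw.1 (key x u hv h.symm hwx)

theorem degreeWithin_pendants (hG : IsCyclicGraph c G) (h3 : 3 ≤ Fintype.card V) {v : V}
    (hv : v ∈ pendants G) : degreeWithin G (pendants G) v = 0 := by
  rw [degreeWithin, Finset.card_eq_zero, Finset.filter_eq_empty_iff]
  exact fun u hu => hG.not_adj_of_pendants h3 hv hu

theorem degree_eq (hG : IsCyclicGraph c G) (h3 : 3 ≤ Fintype.card V) (v : V) :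
    G.degree v = degreeWithin G (nonpendants G) v + degreeWithin G (pendants G) v := by
  rw [← degreeWithin_univ, ← hG.nonpendants_union_pendants h3,
    degreeWithin_union G (disjoint_nonpendants_pendants G)]

theorem card_nonpendants (hG : IsCyclicGraph c G) (h3 : 3 ≤ Fintype.card V) :
    (nonpendants G).card + pendantCount G = Fintype.card V := by
  rw [← Finset.card_univ, ← hG.nonpendants_union_pendants h3,
    Finset.card_union_of_disjoint (disjoint_nonpendants_pendants G)]
  rfl

theorem sum_degree_nonpendants (hG : IsCyclicGraph c G) (h3 : 3 ≤ Fintype.card V) :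
    ∑ v ∈ nonpendants G, G.degree v + pendantCount G = 2 * G.edgeFinset.card := by
  rw [← G.sum_degrees_eq_twice_card_edges, ← hG.nonpendants_union_pendants h3,
    Finset.sum_union (disjoint_nonpendants_pendants G)]
  congr 1
  have h : ∀ v ∈ pendants G, G.degree v = 1 := fun v hv => (Finset.mem_filter.1 hv).2
  rw [Finset.sum_congr rfl h]
  simp only [Finset.sum_const, smul_eq_mul, mul_one]
  rfl

theorem innerDegreeSum_nonpendants (hG : IsCyclicGraph c G) (h3 : 3 ≤ Fintype.card V) :
    innerDegreeSum G (nonpendants G) + 2 * pendantCount G = 2 * G.edgeFinset.card := by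
  have h1 := hG.sum_degree_nonpendants h3
  rw [Finset.sum_congr rfl fun v _ => hG.degree_eq h3 v, Finset.sum_add_distrib,
    sum_degreeWithin_comm G (nonpendants G) (pendants G)] at h1
  have h2 : ∑ v ∈ pendants G, degreeWithin G (nonpendants G) v = pendantCount G := by
    have : ∀ v ∈ pendants G, degreeWithin G (nonpendants G) v = 1 := by
      intro v hv
      have := hG.degree_eq h3 v
      rw [hG.degreeWithin_pendants h3 hv, (Finset.mem_filter.1 hv).2] at this
      omega
    rw [Finset.sum_congr rfl this]
    simp only [Finset.sum_const, smul_eq_mul, mul_one]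
    rfl
  rw [innerDegreeSum]
  omega

/-- The connectivity function in terms of the weights of the non-pendant vertices. -/
theorem connectivityFunction_eq {f : ℝ → ℝ → ℝ} (hf : IsEscalating f)
    (hG : IsCyclicGraph c G) (h3 : 3 ≤ Fintype.card V) :
    connectivityFunction f hf.symm G =
      ∑ v ∈ nonpendants G, hubWeight f (G.degree v) (degreeWithin G (nonpendants G) v) +
        pairInteraction f G (nonpendants G) / 2 + pendantCount G * f 1 2 -
        G.edgeFinset.card * f 2 2 := by
  have hdis := disjoint_nonpendants_pendants G
  have huniv := hG.nonpendants_union_pendants h3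
  have hsplit : ∀ g : V → ℝ, ∑ v, g v = ∑ v ∈ nonpendants G, g v + ∑ v ∈ pendants G, g v := by
    intro g
    rw [← huniv, Finset.sum_union hdis]
  have hfsplit : ∀ (u : V) (g : V → ℝ), ∑ v ∈ Finset.univ.filter (G.Adj u), g v =
      ∑ v ∈ (nonpendants G).filter (G.Adj u), g v + ∑ v ∈ (pendants G).filter (G.Adj u), g v := by
    intro u g
    simp only [Finset.sum_filter]
    exact hsplit _
  have hcard : ∀ u, (Finset.univ.filter (G.Adj u)).card = G.degree u := degreeWithin_univ G
  -- expansion of `f` into one-variable parts and the interaction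
  have e1 : 2 * connectivityFunction f hf.symm G =
      2 * ∑ u, (G.degree u : ℝ) * f (G.degree u) 2 - 2 * G.edgeFinset.card * f 2 2 +
        pairInteraction f G Finset.univ := by
    rw [two_mul_connectivityFunction]
    have h : ∀ u v, f (G.degree u) (G.degree v) = f (G.degree u) 2 + f (G.degree v) 2 - f 2 2 +
        interaction f (G.degree u) (G.degree v) := by
      intro u v; simp only [interaction]; ring
    simp only [h, Finset.sum_add_distrib, Finset.sum_sub_distrib]
    rw [sum_filter_adj_comm G Finset.univ Finset.univ fun _ v => f (G.degree v) 2]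
    simp only [Finset.sum_const, hcard, nsmul_eq_mul]
    rw [← Finset.sum_mul, ← Nat.cast_sum, G.sum_degrees_eq_twice_card_edges, pairInteraction]
    push_cast
    ring
  have e2 : pairInteraction f G Finset.univ = pairInteraction f G (nonpendants G) +
      2 * ∑ u ∈ nonpendants G, degreeWithin G (pendants G) u * interaction f (G.degree u) 1 := by
    have hNL : ∑ u ∈ nonpendants G, ∑ v ∈ (pendants G).filter (G.Adj u),
        interaction f (G.degree u) (G.degree v) =
        ∑ u ∈ nonpendants G, degreeWithin G (pendants G) u * interaction f (G.degree u) 1 := by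
      refine Finset.sum_congr rfl fun u _ => ?_
      rw [degreeWithin, ← nsmul_eq_mul, ← Finset.sum_const]
      refine Finset.sum_congr rfl fun v hv => ?_
      rw [(Finset.mem_filter.1 (Finset.mem_filter.1 hv).1).2]
    have hLN : ∑ u ∈ pendants G, ∑ v ∈ (nonpendants G).filter (G.Adj u),
        interaction f (G.degree u) (G.degree v) =
        ∑ u ∈ nonpendants G, ∑ v ∈ (pendants G).filter (G.Adj u),
          interaction f (G.degree u) (G.degree v) := by
      rw [sum_filter_adj_comm]
      simp only [interaction_comm hf]
    have hLL : ∑ u ∈ pendants G, ∑ v ∈ (pendants G).filter (G.Adj u),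
        interaction f (G.degree u) (G.degree v) = 0 := by
      refine Finset.sum_eq_zero fun u hu => ?_
      rw [Finset.card_eq_zero.1 (hG.degreeWithin_pendants h3 hu), Finset.sum_empty]
    rw [pairInteraction, hsplit]
    simp only [hfsplit, Finset.sum_add_distrib]
    rw [hLL, hLN, hNL, pairInteraction]
    ring
  have e3 : ∑ u ∈ pendants G, (G.degree u : ℝ) * f (G.degree u) 2 = pendantCount G * f 1 2 := by
    rw [Finset.sum_congr rfl fun u hu => by rw [(Finset.mem_filter.1 hu).2]]
    rw [Finset.sum_const, nsmul_eq_mul, Nat.cast_one, one_mul]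
    rfl
  have e4 : ∑ v ∈ nonpendants G, hubWeight f (G.degree v) (degreeWithin G (nonpendants G) v) =
      ∑ u ∈ nonpendants G, (G.degree u : ℝ) * f (G.degree u) 2 +
      ∑ u ∈ nonpendants G, degreeWithin G (pendants G) u * interaction f (G.degree u) 1 := by
    rw [← Finset.sum_add_distrib]
    refine Finset.sum_congr rfl fun u _ => ?_
    have : (G.degree u : ℝ) = degreeWithin G (nonpendants G) u + degreeWithin G (pendants G) u := by
      exact_mod_cast hG.degree_eq h3 u
    simp only [hubWeight, interaction, Nat.cast_one, hf.symm 1 2]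
    linear_combination (f (G.degree u) 1 + f 2 2 - f 2 1 - f (G.degree u) 2) * this
  rw [e4]
  rw [hsplit, e3, e2] at e1
  linarith

/-- The handshake lemma makes the final hub degree an invariant of the class, so the bound obtained
by merging can be compared across graphs. -/
theorem hubDegree_nonpendants (hG : IsCyclicGraph c G) (h3 : 3 ≤ Fintype.card V) :
    hubDegree G (nonpendants G) = pendantCount G + 2 * c := by
  have h1 := hG.sum_degree_nonpendants h3
  have h2 := hG.card_nonpendants h3
  have h4 := hG.2
  have h5 : ∑ v ∈ nonpendants G, G.degree v =
      ∑ v ∈ nonpendants G, (G.degree v - 2) + 2 * (nonpendants G).card := by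
    rw [mul_comm, ← smul_eq_mul, ← Finset.sum_const, ← Finset.sum_add_distrib]
    refine Finset.sum_congr rfl fun v hv => ?_
    have : 2 ≤ G.degree v := (Finset.mem_filter.1 hv).2
    omega
  rw [hubDegree]
  omega

theorem connectivityFunction_le_of_mergeBound {f : ℝ → ℝ → ℝ} (hf : IsGoodEscalating f)
    (hG : IsCyclicGraph c G) (h3 : 3 ≤ Fintype.card V) {a : V → ℝ} {α : ℝ}
    (ha : ∀ v ∈ nonpendants G, (degreeWithin G (nonpendants G) v : ℝ) ≤ a v)
    (h : MergeBound f G a (nonpendants G) α) :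
    connectivityFunction f hf.symm G ≤ hubWeight f (pendantCount G + 2 * c) α +
      2 * ((nonpendants G).card - 1) * f 2 2 + pendantCount G * f 1 2 -
        G.edgeFinset.card * f 2 2 := by
  rw [hG.connectivityFunction_eq hf.toIsEscalating h3]
  rw [MergeBound, hG.hubDegree_nonpendants h3, Finset.sum_sub_distrib, Finset.sum_const,
    nsmul_eq_mul] at h
  have h1 : ∑ v ∈ nonpendants G, hubWeight f (G.degree v) (degreeWithin G (nonpendants G) v) ≤
      ∑ v ∈ nonpendants G, hubWeight f (G.degree v) (a v) :=
    Finset.sum_le_sum fun v hv => hubWeight_mono hf.toIsEscalating (Finset.mem_filter.1 hv).2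
      (ha v hv)
  linarith

end IsCyclicGraph

end

/-! ### The two upper bounds -/

section

open Classical

variable {V : Type*} [Fintype V]

namespace IsCyclicGraph

variable {c : ℕ} {G : SimpleGraph V} {f : ℝ → ℝ → ℝ}

theorem mergeBound_degree (hf : IsGoodEscalating f) (hc : c ≤ 2) (hG : IsCyclicGraph c G)
    (h3 : 3 ≤ Fintype.card V) :
    MergeBound f G (fun v => G.degree v) (nonpendants G) (pendantCount G + 2 * c : ℕ) := by
  have hd : ∀ u ∈ nonpendants G, 2 ≤ G.degree u := fun u hu => (Finset.mem_filter.1 hu).2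
  have h := hG.mergeBound_of_two_le hf hc (a := fun v => G.degree v) (nonpendants G) hd
    fun u hu => by exact_mod_cast hd u hu
  convert h using 1
  rw [← hG.hubDegree_nonpendants h3, hubDegree]
  push_cast
  congr 1
  refine Finset.sum_congr rfl fun u hu => ?_
  rw [Nat.cast_sub (hd u hu), Nat.cast_two]

theorem innerDegreeSum_nonpendants_add_two (hG : IsCyclicGraph c G) (h3 : 3 ≤ Fintype.card V) :
    innerDegreeSum G (nonpendants G) + 2 = 2 * ((nonpendants G).card + c) := by
  have h1 := hG.innerDegreeSum_nonpendants h3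
  have h2 := hG.card_nonpendants h3
  have h4 := hG.2
  omega

/-- The non-pendant vertices span exactly |N| + c - 1 edges, and deleting v leaves at most |N| + c -
2, so some edge is lost. -/
theorem one_le_degreeWithin_nonpendants (hG : IsCyclicGraph c G) (h3 : 3 ≤ Fintype.card V)
    (h2 : 2 ≤ (nonpendants G).card) {v : V} (hv : v ∈ nonpendants G) :
    1 ≤ degreeWithin G (nonpendants G) v := by
  have h1 := hG.innerDegreeSum_nonpendants_add_two h3
  have hne : ((nonpendants G).erase v).Nonempty :=
    Finset.card_pos.1 (by rw [Finset.card_erase_of_mem hv]; omega)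
  have h4 := hG.innerDegreeSum_le hne
  have h5 := innerDegreeSum_insert G (Finset.notMem_erase v (nonpendants G))
  have h6 := degreeWithin_mono G ((nonpendants G).erase_subset v) v
  rw [Finset.insert_erase hv] at h5
  rw [Finset.card_erase_of_mem hv] at h4
  omega

/-- A set of four vertices that spans at least five edges can be merged into a hub of smaller
weight. -/
theorem mergeBound_of_card_eq_four (hf : IsGoodEscalating f) (hc : c ≤ 2)
    (hG : IsCyclicGraph c G) {S T : Finset V} (hST : S ⊆ T) (hS : ∀ u ∈ S, 2 ≤ G.degree u)
    (hS2 : ∀ u ∈ S, 2 ≤ degreeWithin G T u) (hcard : S.card = 4) (he : 10 ≤ innerDegreeSum G S) :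
    MergeBound f G (fun v => degreeWithin G T v) S
      (1 + ∑ u ∈ S, ((degreeWithin G T u : ℝ) - 2)) := by
  have hub := hG.innerDegreeSum_le (S := S) (Finset.card_pos.1 (by omega))
  -- Since c ≤ 2, the set S spans at most five edges and is not complete: it is a complete graph on
  -- four vertices minus the edge wx.
  obtain ⟨w, hw, x, hx, hwx, hadj⟩ : ∃ w ∈ S, ∃ x ∈ S, w ≠ x ∧ ¬ G.Adj w x := by
    by_contra! h
    have : ∑ v ∈ S, 3 ≤ innerDegreeSum G S := by
      refine Finset.sum_le_sum fun v hv => ?_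
      have h1 : S.erase v ⊆ S.filter (G.Adj v) := fun u hu => Finset.mem_filter.2
        ⟨Finset.mem_of_mem_erase hu, h v hv u (Finset.mem_of_mem_erase hu)
          (Finset.ne_of_mem_erase hu).symm⟩
      have h2 := Finset.card_le_card h1
      rw [Finset.card_erase_of_mem hv] at h2
      rw [degreeWithin]
      omega
    rw [Finset.sum_const, smul_eq_mul] at this
    omega
  have hx' : x ∈ S.erase w := Finset.mem_erase.2 ⟨hwx.symm, hx⟩
  obtain ⟨a, b, hab, hSab⟩ := Finset.card_eq_two.1
    (show ((S.erase w).erase x).card = 2 by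
      rw [Finset.card_erase_of_mem hx', Finset.card_erase_of_mem hw]; omega)
  have hS' : S = insert w (insert x {b, a}) := by
    rw [Finset.pair_comm, ← hSab, Finset.insert_erase hx', Finset.insert_erase hw]
  have hxab : x ∉ ({b, a} : Finset V) := by
    rw [Finset.pair_comm, ← hSab]; exact Finset.notMem_erase _ _
  have hwxab : w ∉ insert x ({b, a} : Finset V) := by
    rw [Finset.pair_comm, ← hSab, Finset.insert_erase hx']; exact Finset.notMem_erase _ _
  have hba : b ∉ ({a} : Finset V) := by simpa using hab.symm
  have hw2 : degreeWithin G S w ≤ 2 := degreeWithin_le_two G (a := b) (b := a) fun u hu hwu => by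
    rw [hS'] at hu
    simp only [Finset.mem_insert, Finset.mem_singleton] at hu
    rcases hu with rfl | rfl | hu
    · simp at hwu
    · exact absurd hwu hadj
    · exact hu
  have hx2 : degreeWithin G S x ≤ 2 := degreeWithin_le_two G (a := b) (b := a) fun u hu hxu => by
    rw [hS'] at hu
    simp only [Finset.mem_insert, Finset.mem_singleton] at hu
    rcases hu with rfl | rfl | hu
    · exact absurd hxu.symm hadj
    · simp at hxu
    · exact hu
  have haS : a ∈ S := by rw [hS']; simp
  have hbS : b ∈ S := by rw [hS']; simp
  have ha4 := degreeWithin_lt_card G haS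
  have hb4 := degreeWithin_lt_card G hbS
  have hsum : ∀ g : V → ℕ, ∑ v ∈ S, g v = g w + (g x + (g b + g a)) := by
    intro g
    conv_lhs => rw [hS']
    rw [Finset.sum_insert hwxab, Finset.sum_insert hxab, Finset.sum_insert hba,
      Finset.sum_singleton]
  have hsum' : ∀ g : V → ℝ, ∑ v ∈ S, g v = g w + (g x + (g b + g a)) := by
    intro g
    conv_lhs => rw [hS']
    rw [Finset.sum_insert hwxab, Finset.sum_insert hxab, Finset.sum_insert hba,
      Finset.sum_singleton]
  have he' := he
  rw [innerDegreeSum, hsum] at he'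
  have haT : 3 ≤ degreeWithin G T a := le_trans (by omega) (degreeWithin_mono G hST a)
  have hbT : 3 ≤ degreeWithin G T b := le_trans (by omega) (degreeWithin_mono G hST b)
  have hdT : ∀ u, degreeWithin G T u ≤ G.degree u := fun u => by
    rw [← degreeWithin_univ]; exact degreeWithin_mono G (Finset.subset_univ T) u
  have haT' : (3 : ℝ) ≤ degreeWithin G T a := by exact_mod_cast haT
  have hbT' : (3 : ℝ) ≤ degreeWithin G T b := by exact_mod_cast hbT
  have hwT' : (2 : ℝ) ≤ degreeWithin G T w := by exact_mod_cast hS2 w hw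
  have hxT' : (2 : ℝ) ≤ degreeWithin G T x := by exact_mod_cast hS2 x hx
  -- The two vertices of inner degree 3 are merged first, at a loss of 3; then x and w at a loss of
  -- 2 each. The total loss 7 exceeds by one that of three merges losing 2.
  have b1 := mergeBound_singleton f (fun v => (degreeWithin G T v : ℝ)) (hS a haS)
  have b2 := b1.insert_three hf (by simpa using hS a haS) hba (le_trans hbT (hdT b))
    ((Finset.card_filter_le _ _).trans (by simp)) haT' hbT'
  have b3 := b2.insert_two hf (by simp [hS a haS, hS b hbS]) hxab (hS x hx)
    ((Finset.card_filter_le _ _).trans Finset.card_le_two) (by linarith) hxT'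
  have b4 := b3.insert_two hf (by simp [hS a haS, hS b hbS, hS x hx]) hwxab (hS w hw)
    (le_trans (degreeWithin_mono G (by rw [hS']; exact Finset.subset_insert _ _) w) hw2)
    (by linarith) hwT'
  rw [← hS'] at b4
  rw [hsum']
  convert b4 using 1
  ring

/-- For trees, losing 1 at each merge gives |N| - 1 exactly. For c ≥ 1, let C be the vertices with
at least two non-pendant neighbours. Merging C at a loss of 2 each gives |N| + 2c - |C|, which
suffices once |C| ≥ 2c + 1. The other vertices, with one non-pendant neighbour each, are then merged
for free. -/
theorem mergeBound_degreeWithin (hf : IsGoodEscalating f) (hc : c ≤ 2) (hG : IsCyclicGraph c G)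
    (h3 : 3 ≤ Fintype.card V) :
    MergeBound f G (fun v => degreeWithin G (nonpendants G) v) (nonpendants G)
      ((nonpendants G).card - 1) := by
  have hd : ∀ u ∈ nonpendants G, 2 ≤ G.degree u := fun u hu => (Finset.mem_filter.1 hu).2
  rcases Nat.lt_or_ge (nonpendants G).card 2 with h2 | h2
  · rcases Nat.lt_or_ge (nonpendants G).card 1 with h1 | h1
    · rw [Finset.card_eq_zero.1 (Nat.lt_one_iff.1 h1)]
      exact mergeBound_empty ..
    · obtain ⟨v, hv⟩ := Finset.card_eq_one.1 (show (nonpendants G).card = 1 by omega)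
      have h := mergeBound_singleton f (fun v => (degreeWithin G (nonpendants G) v : ℝ))
        (hd v (by simp [hv]))
      rw [hv] at h ⊢
      have h0 : degreeWithin G {v} v = 0 := by simp [degreeWithin, Finset.filter_singleton]
      simpa [h0] using h
  have hA := fun v (hv : v ∈ nonpendants G) => hG.one_le_degreeWithin_nonpendants h3 h2 hv
  have hsum := hG.innerDegreeSum_nonpendants_add_two h3
  set N := nonpendants G with hN
  have hsumR : ∑ v ∈ N, (degreeWithin G N v : ℝ) = 2 * (N.card + c) - 2 := by
    have : (innerDegreeSum G N : ℝ) + 2 = 2 * (N.card + c) := by exact_mod_cast hsum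
    rw [innerDegreeSum] at this
    push_cast at this
    linarith
  rcases Nat.eq_zero_or_pos c with rfl | hc1
  · have h := hG.mergeBound_tree hf (a := fun v => (degreeWithin G N v : ℝ)) N hd
      fun u hu => by exact_mod_cast hA u hu
    convert h using 1
    rw [Finset.sum_sub_distrib, hsumR, Finset.sum_const, nsmul_eq_mul]
    push_cast
    ring
  set C := N.filter fun v => 2 ≤ degreeWithin G N v with hC
  set T := N.filter fun v => ¬ 2 ≤ degreeWithin G N v with hT
  have hCT : C ∪ T = N := Finset.filter_union_filter_not_eq _ _
  have hdis : Disjoint C T := Finset.disjoint_filter_filter_not _ _ _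
  have hT1 : ∀ u ∈ T, degreeWithin G N u = 1 := by
    intro u hu
    rw [hT, Finset.mem_filter] at hu
    have := hA u hu.1
    omega
  have hC2 : ∀ u ∈ C, 2 ≤ degreeWithin G N u := fun u hu => (Finset.mem_filter.1 hu).2
  have hCd : ∀ u ∈ C, 2 ≤ G.degree u := fun u hu => hd u (Finset.mem_filter.1 hu).1
  have hcard : C.card + T.card = N.card := by
    rw [← hCT, Finset.card_union_of_disjoint hdis]
  have hsumC : ∑ u ∈ C, degreeWithin G N u + T.card = innerDegreeSum G N := by
    rw [innerDegreeSum]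
    conv_rhs => rw [← hCT, Finset.sum_union hdis, hCT, Finset.sum_congr rfl hT1]
    simp
  have hinner : ∑ u ∈ C, degreeWithin G N u ≤ innerDegreeSum G C + T.card := by
    conv_lhs => rw [← hCT]
    simp only [degreeWithin_union G hdis]
    rw [Finset.sum_add_distrib, sum_degreeWithin_comm G C T, innerDegreeSum]
    refine Nat.add_le_add_left ?_ _
    rw [Finset.card_eq_sum_ones]
    refine Finset.sum_le_sum fun u hu => ?_
    rw [← hT1 u hu]
    exact degreeWithin_mono G (Finset.filter_subset _ _) u
  have hupper : innerDegreeSum G C ≤ C.card * (C.card - 1) := by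
    rw [← smul_eq_mul, ← Finset.sum_const]
    exact Finset.sum_le_sum fun u hu => by have := degreeWithin_lt_card G hu; omega
  have hsumCR : ∑ u ∈ C, ((degreeWithin G N u : ℝ) - 2) = N.card + 2 * c - 2 - C.card := by
    have e1 : (∑ u ∈ C, (degreeWithin G N u : ℝ)) + T.card + 2 = 2 * (N.card + c) := by
      exact_mod_cast (by omega : ∑ u ∈ C, degreeWithin G N u + T.card + 2 = 2 * (N.card + c))
    have e2 : (C.card : ℝ) + T.card = N.card := by exact_mod_cast hcard
    rw [Finset.sum_sub_distrib, Finset.sum_const, nsmul_eq_mul]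
    linarith
  have hfin : MergeBound f G (fun v => degreeWithin G N v) C (N.card - 1) →
      MergeBound f G (fun v => degreeWithin G N v) N (N.card - 1) := by
    intro h
    have h2' : (2 : ℝ) ≤ N.card := by exact_mod_cast h2
    have := h.union_of_one hf (by linarith) T hdis (by rw [hCT]; exact hd)
      (fun u hu => by exact_mod_cast hT1 u hu) (by rw [hCT]; exact fun u hu => (hT1 u hu).le)
    rwa [hCT] at this
  refine hfin ?_
  -- Edge counting gives 2|C| + 2c - 2 ≤ |C|(|C| - 1), so |C| ≥ 3 for c = 1 and |C| ≥ 4 for c = 2.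
  -- Only the value 4 in the bicyclic case falls short by one.
  have hCge : 2 * c + 1 ≤ C.card ∨ c = 2 ∧ C.card = 4 := by
    have hpos : C.card ≠ 0 := by
      intro h0
      rw [Finset.card_eq_zero.1 h0, Finset.sum_empty] at hsumC
      omega
    have key : 2 * C.card + 2 * c ≤ C.card * (C.card - 1) + 2 := by omega
    by_contra! hcon
    generalize C.card = t at key hpos hcon
    have hlt : t ≤ 4 := by omega
    interval_cases c <;> interval_cases t <;> omega
  rcases hCge with hge | ⟨rfl, h4⟩
  · have h := hG.mergeBound_of_two_le hf hc (a := fun v => (degreeWithin G N v : ℝ)) C hCd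
      fun u hu => by exact_mod_cast hC2 u hu
    refine h.mono hf.toIsEscalating ?_
    have : (2 * c + 1 : ℝ) ≤ C.card := by exact_mod_cast hge
    rw [hsumCR]
    linarith
  · have h := hG.mergeBound_of_card_eq_four hf hc (S := C) (Finset.filter_subset _ N) hCd hC2 h4 (by omega)
    convert h using 1
    rw [hsumCR, h4]
    push_cast
    ring

/-- The upper bound for the connectivity function of a `c`-cyclic graph. -/
theorem connectivityFunction_le (hf : IsGoodEscalating f) (hc : c ≤ 2) (hG : IsCyclicGraph c G)
    (h3 : 3 ≤ Fintype.card V) {α : ℝ}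
    (hα : α = (pendantCount G + 2 * c : ℕ) ∨ α = (nonpendants G).card - 1) :
    connectivityFunction f hf.symm G ≤ hubWeight f (pendantCount G + 2 * c) α +
      2 * ((nonpendants G).card - 1) * f 2 2 + pendantCount G * f 1 2 -
        G.edgeFinset.card * f 2 2 := by
  rcases hα with rfl | rfl
  · refine hG.connectivityFunction_le_of_mergeBound hf h3 (fun v _ => ?_)
      (hG.mergeBound_degree hf hc h3)
    rw [← degreeWithin_univ]
    exact_mod_cast degreeWithin_mono G (Finset.subset_univ _) v
  · exact hG.connectivityFunction_le_of_mergeBound hf h3 (fun v _ => le_rfl)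
      (hG.mergeBound_degreeWithin hf hc h3)

/-- The connectivity function of a `c`-cyclic graph with at most one branching vertex. -/
theorem connectivityFunction_eq_of_hub (hf : IsEscalating f) (hG : IsCyclicGraph c G)
    (h3 : 3 ≤ Fintype.card V) {r : V} (hr : r ∈ nonpendants G)
    (h : ∀ v ∈ nonpendants G, v ≠ r → G.degree v = 2) :
    connectivityFunction f hf.symm G =
      hubWeight f (G.degree r) (degreeWithin G (nonpendants G) r) +
      2 * ((nonpendants G).card - 1) * f 2 2 + pendantCount G * f 1 2 -
        G.edgeFinset.card * f 2 2 := by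
  have h1 : ∑ v ∈ nonpendants G, hubWeight f (G.degree v) (degreeWithin G (nonpendants G) v) =
      hubWeight f (G.degree r) (degreeWithin G (nonpendants G) r) +
      2 * ((nonpendants G).card - 1) * f 2 2 := by
    rw [← Finset.add_sum_erase _ _ hr]
    congr 1
    rw [Finset.sum_congr rfl (g := fun _ => 2 * f 2 2), Finset.sum_const,
      Finset.card_erase_of_mem hr, nsmul_eq_mul, Nat.cast_sub (Finset.card_pos.2 ⟨r, hr⟩)]
    · push_cast; ring
    · intro v hv
      rw [h v (Finset.mem_of_mem_erase hv) (Finset.ne_of_mem_erase hv), hubWeight_two]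
  have h2 : pairInteraction f G (nonpendants G) = 0 := by
    refine Finset.sum_eq_zero fun u hu => Finset.sum_eq_zero fun v hv => ?_
    rw [Finset.mem_filter] at hv
    by_cases hur : u = r
    · rw [h v hv.1 fun hvr => hv.2.ne (hur.trans hvr.symm)]
      exact interaction_two_right _
    · rw [h u hu hur]
      exact interaction_two_left hf _
  rw [hG.connectivityFunction_eq hf h3, h1, h2]
  ring

end IsCyclicGraph

end

/-! ### Graphs with attached paths -/

section

open Classical

theorem Fin.sum_ite_val_eq {n : ℕ} (m : ℕ) :
    (∑ j : Fin n, if m = j.val then 1 else 0) = if m < n then 1 else 0 := by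
  rw [Fin.sum_univ_eq_sum_range (fun j => if m = j then 1 else 0) n, Finset.sum_ite_eq]
  simp

theorem SimpleGraph.degree_eq_sum {V : Type*} [Fintype V] (G : SimpleGraph V) (v : V) :
    G.degree v = ∑ w, if G.Adj v w then 1 else 0 := by
  rw [← degreeWithin_univ, degreeWithin, Finset.card_filter]

section

variable {V : Type*} {H : SimpleGraph V} {r : V} {k : ℕ} {l : Fin k → ℕ}

theorem attachPaths_connected (hH : H.Connected) :
    (attachPaths H r l).Connected := by
  have hinl : ∀ u v, (attachPaths H r l).Reachable (.inl u) (.inl v) := fun u v =>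
    (hH.preconnected u v).map
      (⟨Sum.inl, fun h => h⟩ : H →g attachPaths H r l)
  have hinr : ∀ (i : Fin k) (m : ℕ) (hm : m < l i),
      (attachPaths H r l).Reachable (.inl r) (.inr ⟨i, ⟨m, hm⟩⟩) := by
    intro i m
    induction m with
    | zero => exact fun hm => SimpleGraph.Adj.reachable ⟨rfl, rfl⟩
    | succ m ih =>
      exact fun hm => (ih (by omega)).trans (SimpleGraph.Adj.reachable ⟨rfl, Or.inl rfl⟩)
  have hr : ∀ x, (attachPaths H r l).Reachable (.inl r) x := by
    rintro (u | ⟨i, j⟩)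
    · exact hinl r u
    · exact hinr i j.1 j.2
  exact (SimpleGraph.connected_iff _).2 ⟨fun x y => (hr x).symm.trans (hr y), ⟨.inl r⟩⟩

theorem sum_ite_lt_length {n : ℕ} (hn : 1 ≤ n) (a b : ℕ) :
    (∑ j : Fin n, if j.val + 1 < n then a else b) + a = n * a + b := by
  obtain ⟨m, rfl⟩ := Nat.exists_eq_add_of_le' hn
  rw [Fin.sum_univ_castSucc]
  simp
  ring

/-- Each path has one free end, counted with b, and its other vertices are counted with a. The
values (2, 1) serve for the degree sum and (0, 1) for the number of pendant vertices. -/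
theorem sum_attachPaths {M : ℕ} (a b : ℕ) (hl : ∀ i, 1 ≤ l i) (hM : ∑ i, l i = M) :
    (∑ p : Σ i : Fin k, Fin (l i), if p.2.val + 1 < l p.1 then a else b) + k * a =
      M * a + k * b := by
  rw [Fintype.sum_sigma, ← hM, Finset.sum_mul]
  have h : k * a = ∑ _i : Fin k, a := by simp
  have h' : k * b = ∑ _i : Fin k, b := by simp
  rw [h, h', ← Finset.sum_add_distrib, ← Finset.sum_add_distrib]
  exact Finset.sum_congr rfl fun i _ => sum_ite_lt_length (hl i) a b

variable [Fintype V]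

theorem attachPaths_degree_inl (hl : ∀ i, 1 ≤ l i) (u : V) :
    (attachPaths H r l).degree (.inl u) = H.degree u + if u = r then k else 0 := by
  rw [SimpleGraph.degree_eq_sum, Fintype.sum_sum_type, H.degree_eq_sum]
  congr 1
  rw [Fintype.sum_sigma]
  have h : ∀ i : Fin k, (∑ j : Fin (l i),
      if (attachPaths H r l).Adj (.inl u) (.inr ⟨i, j⟩) then 1 else 0) =
      if u = r then 1 else 0 := by
    intro i
    by_cases hu : u = r
    · have := Fin.sum_ite_val_eq (n := l i) 0
      rw [if_pos (show 0 < l i from hl i)] at this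
      simpa [attachPaths, hu, eq_comm] using this
    · simp [attachPaths, hu]
  simp only [h]
  split_ifs <;> simp

theorem attachPaths_degree_inr (i : Fin k) (j : Fin (l i)) :
    (attachPaths H r l).degree (.inr ⟨i, j⟩) = if j.val + 1 < l i then 2 else 1 := by
  rw [SimpleGraph.degree_eq_sum, Fintype.sum_sum_type, Fintype.sum_sigma]
  have h1 : (∑ u, if (attachPaths H r l).Adj (.inr ⟨i, j⟩) (.inl u) then 1 else 0) =
      if j.val = 0 then 1 else 0 := by
    by_cases hj : j.val = 0 <;> simp [attachPaths, hj]
  have h2 : ∀ i' : Fin k, i' ≠ i → (∑ j' : Fin (l i'),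
      if (attachPaths H r l).Adj (.inr ⟨i, j⟩) (.inr ⟨i', j'⟩) then 1 else 0) = 0 := by
    intro i' hi'
    simp [attachPaths, hi'.symm]
  have h3 : (∑ j' : Fin (l i),
      if (attachPaths H r l).Adj (.inr ⟨i, j⟩) (.inr ⟨i, j'⟩) then 1 else 0) =
      (if j.val + 1 < l i then 1 else 0) + if j.val = 0 then 0 else 1 := by
    -- The two terms account for the successor and the predecessor on the path. The first path
    -- vertex has no predecessor there; its other neighbour is r, counted separately.
    have e : ∀ j' : Fin (l i),
        (if (attachPaths H r l).Adj (.inr ⟨i, j⟩) (.inr ⟨i, j'⟩) then 1 else 0) =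
        (if j.val + 1 = j'.val then 1 else 0) +
          if j.val = 0 then 0 else if j.val - 1 = j'.val then 1 else 0 := by
      intro j'
      simp only [attachPaths, true_and]
      split_ifs <;> omega
    simp only [e, Finset.sum_add_distrib, Fin.sum_ite_val_eq]
    congr 1
    by_cases hj : j.val = 0
    · simp [hj]
    · simp only [hj, if_false, Fin.sum_ite_val_eq]
      rw [if_pos (by omega)]
  rw [h1, Finset.sum_eq_single i (fun i' _ hi' => h2 i' hi') (by simp), h3]
  split_ifs <;> rfl

variable {c : ℕ}

theorem isCyclicGraph_attachPaths (hl : ∀ i, 1 ≤ l i) (hH : IsCyclicGraph c H) :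
    IsCyclicGraph c (attachPaths H r l) := by
  refine ⟨attachPaths_connected hH.1, ?_⟩
  have h1 := (attachPaths H r l).sum_degrees_eq_twice_card_edges
  rw [Fintype.sum_sum_type] at h1
  simp only [attachPaths_degree_inl hl, Finset.sum_add_distrib,
    H.sum_degrees_eq_twice_card_edges, Finset.sum_ite_eq', Finset.mem_univ, if_true] at h1
  have h2 := sum_attachPaths (l := l) 2 1 hl rfl
  have h3 : ∑ p : Σ i : Fin k, Fin (l i), (attachPaths H r l).degree (.inr p) =
      ∑ p : Σ i : Fin k, Fin (l i), if p.2.val + 1 < l p.1 then 2 else 1 :=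
    Finset.sum_congr rfl fun p _ => attachPaths_degree_inr p.1 p.2
  have h4 := hH.2
  rw [Fintype.card_sum, Fintype.card_sigma]
  simp only [Fintype.card_fin]
  omega

theorem pendantCount_attachPaths (hl : ∀ i, 1 ≤ l i)
    (hH : ∀ u, 2 ≤ (attachPaths H r l).degree (.inl u)) :
    pendantCount (attachPaths H r l) = k := by
  have h2 := sum_attachPaths (l := l) 0 1 hl rfl
  rw [pendantCount, Finset.card_filter, Fintype.sum_sum_type]
  rw [Finset.sum_eq_zero fun u _ => if_neg (by have := hH u; omega), zero_add]
  simp only [mul_zero, mul_one, add_zero, zero_add] at h2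
  refine Eq.trans (Finset.sum_congr rfl fun p _ => ?_) h2
  rw [show (attachPaths H r l).degree (.inr p) = _ from attachPaths_degree_inr p.1 p.2]
  split_ifs <;> simp_all

/-- Attaching paths of almost equal lengths to the centre of `c` triangles sharing a vertex yields
an extremal graph. -/
theorem isExtremalGraph_attachPaths {f : ℝ → ℝ → ℝ} (hf : IsGoodEscalating f) (hc : c ≤ 2)
    (hV : Fintype.card V = 2 * c + 1) (hadj : ∀ u, u ≠ r → H.Adj r u)
    (hdeg : ∀ u, u ≠ r → H.degree u = 2) (hkc : 2 ≤ k + 2 * c) {n : ℕ}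
    (hl : AlmostEqualLengths l) (hn : 2 * c + 1 + ∑ i, l i = n) :
    IsExtremalGraph hf.toIsEscalating c n k (attachPaths H r l) := by
  set G := attachPaths H r l with hG
  have hr : H.degree r = 2 * c := by
    have h : Finset.univ.filter (H.Adj r) = Finset.univ.erase r := by
      ext u
      simp only [Finset.mem_filter, Finset.mem_univ, true_and, Finset.mem_erase, and_true]
      exact ⟨fun h => h.ne', hadj u⟩
    rw [← degreeWithin_univ, degreeWithin, h, Finset.card_erase_of_mem (Finset.mem_univ _),
      Finset.card_univ, hV, Nat.add_sub_cancel]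
  have hH : IsCyclicGraph c H := by
    have hreach : ∀ u, H.Reachable r u := by
      intro u
      by_cases hu : u = r
      · rw [hu]
      · exact (hadj u hu).reachable
    refine ⟨(SimpleGraph.connected_iff _).2
      ⟨fun u v => (hreach u).symm.trans (hreach v), ⟨r⟩⟩, ?_⟩
    have h1 := H.sum_degrees_eq_twice_card_edges
    rw [← Finset.add_sum_erase _ _ (Finset.mem_univ r), hr,
      Finset.sum_congr rfl fun u hu => hdeg u (Finset.ne_of_mem_erase hu), Finset.sum_const,
      Finset.card_erase_of_mem (Finset.mem_univ r), Finset.card_univ, smul_eq_mul] at h1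
    omega
  have hGr : G.degree (.inl r) = k + 2 * c := by
    rw [hG, attachPaths_degree_inl hl.1, hr, if_pos rfl, add_comm]
  have hGu : ∀ u, u ≠ r → G.degree (.inl u) = 2 := fun u hu => by
    rw [hG, attachPaths_degree_inl hl.1, hdeg u hu, if_neg hu]
  have hGl : ∀ u, 2 ≤ G.degree (.inl u) := by
    intro u
    by_cases hu : u = r
    · rw [hu, hGr]; exact hkc
    · rw [hGu u hu]
  have hGc : IsCyclicGraph c G := isCyclicGraph_attachPaths hl.1 hH
  have hGp : pendantCount G = k := pendantCount_attachPaths hl.1 hGl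
  have hGn : Fintype.card (V ⊕ (Σ i : Fin k, Fin (l i))) = n := by
    rw [Fintype.card_sum, Fintype.card_sigma, hV]
    simpa using hn
  have hkl : k ≤ ∑ i, l i := by
    have : ∑ _i : Fin k, 1 ≤ ∑ i, l i := Finset.sum_le_sum fun i _ => hl.1 i
    simpa using this
  have h3 : 3 ≤ n := by omega
  refine ⟨⟨hGc, hGn, hGp⟩, fun W _ K hK => ?_⟩
  obtain ⟨hKc, hKn, hKp⟩ := hK
  have hKN := hKc.card_nonpendants (by omega)
  have hGN := hGc.card_nonpendants (by omega)
  have hrN : Sum.inl r ∈ nonpendants G := by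
    rw [nonpendants, Finset.mem_filter]; exact ⟨Finset.mem_univ _, hGl r⟩
  have hother : ∀ v ∈ nonpendants G, v ≠ Sum.inl r → G.degree v = 2 := by
    rintro (u | ⟨i, j⟩) hv hvr
    · exact hGu u fun h => hvr (by rw [h])
    · have := (Finset.mem_filter.1 hv).2
      rw [hG, attachPaths_degree_inr] at this ⊢
      split_ifs at this ⊢ <;> omega
  have hNeq : (nonpendants G).card = (nonpendants K).card := by omega
  have hEeq : G.edgeFinset.card = K.edgeFinset.card := by
    have := hGc.2
    have := hKc.2
    omega
  -- either all neighbours of the centre are non-pendant, or it is adjacent to all non-pendant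
  -- vertices
  have hA : degreeWithin G (nonpendants G) (.inl r) = k + 2 * c ∨
      degreeWithin G (nonpendants G) (.inl r) + 1 = (nonpendants G).card := by
    by_cases h2 : ∀ i, 2 ≤ l i
    · left
      rw [← hGr, ← degreeWithin_univ, degreeWithin, degreeWithin]
      congr 1
      ext v
      simp only [Finset.mem_filter, Finset.mem_univ, true_and, and_iff_right_iff_imp]
      intro hv
      rw [nonpendants, Finset.mem_filter]
      refine ⟨Finset.mem_univ _, ?_⟩
      obtain u | ⟨i, j⟩ := v
      · exact hGl u
      · have hj : j.val = 0 := hv.2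
        have := h2 i
        rw [hG, attachPaths_degree_inr, if_pos (by omega)]
    · right
      push Not at h2
      obtain ⟨i₀, hi₀⟩ := h2
      have hle : ∀ i, l i ≤ 2 := by
        intro i
        have := abs_le.1 (hl.2 i i₀)
        omega
      have hpos := Finset.card_pos.2 ⟨_, hrN⟩
      rw [show degreeWithin G (nonpendants G) (.inl r) = ((nonpendants G).erase (.inl r)).card from ?_,
        Finset.card_erase_of_mem hrN]
      · omega
      rw [degreeWithin]
      congr 1
      ext v
      rw [Finset.mem_filter, Finset.mem_erase, and_comm, and_congr_left_iff]
      intro hv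
      refine ⟨fun h => h.ne', fun hne => ?_⟩
      obtain u | ⟨i, j⟩ := v
      · exact hadj u fun h => hne (by rw [h])
      · have hv := (Finset.mem_filter.1 hv).2
        rw [hG, attachPaths_degree_inr] at hv
        refine ⟨rfl, ?_⟩
        have := hle i
        split_ifs at hv with hj
        · change j.val = 0
          omega
        · omega
  -- The parameter of the centre of G is used in the bound for the competitor K, which is legitimate
  -- because both graphs have the same number of non-pendant vertices.
  have hub := hKc.connectivityFunction_le hf hc (by omega)
    (α := degreeWithin G (nonpendants G) (.inl r)) (by
      rw [hKp, ← hNeq]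
      refine hA.imp (fun h => by rw [h]) fun h => ?_
      rw [← h]; push_cast; ring)
  rw [hGc.connectivityFunction_eq_of_hub hf.toIsEscalating (by omega) hrN hother, hGr, hGp, hNeq,
    hEeq]
  rwa [hKp] at hub

end

end

/-! ### Existence of the lengths and the three classes -/

theorem exists_almostEqualLengths {k m : ℕ} (hk : 1 ≤ k) (hkm : k ≤ m) :
    ∃ l : Fin k → ℕ, AlmostEqualLengths l ∧ ∑ i, l i = m := by
  refine ⟨fun i => m / k + if i.val < m % k then 1 else 0, ⟨fun i => ?_, fun i j => ?_⟩, ?_⟩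
  · have := (Nat.one_le_div_iff hk).2 hkm
    simp only
    omega
  · simp only [abs_le]
    split_ifs <;> push_cast <;> omega
  · rw [Finset.sum_add_distrib, Fin.sum_univ_eq_sum_range (fun i => if i < m % k then 1 else 0) k,
      ← Finset.sum_filter, Finset.sum_const, Finset.sum_const, Finset.card_univ, Fintype.card_fin]
    have h : (Finset.range k).filter (· < m % k) = Finset.range (m % k) := by
      ext i
      have := Nat.mod_lt m hk
      simp only [Finset.mem_filter, Finset.mem_range]
      omega
    rw [h, Finset.card_range, smul_eq_mul, smul_eq_mul, mul_one]
    exact Nat.div_add_mod m k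

theorem bowtie_adj_zero : ∀ u : Fin 5, u ≠ 0 → bowtie.Adj 0 u := by
  intro u hu
  fin_cases u <;> simp_all [bowtie]

open Classical in
theorem bowtie_degree_eq_two (u : Fin 5) (hu : u ≠ 0) : bowtie.degree u = 2 := by
  have h : ∀ u v : Fin 5, bowtie.Adj u v ↔ (u ≠ v ∧ (u = 0 ∨ v = 0 ∨ (u = 1 ∧ v = 2) ∨
      (u = 2 ∧ v = 1) ∨ (u = 3 ∧ v = 4) ∨ (u = 4 ∧ v = 3))) := by
    intro u v
    fin_cases u <;> fin_cases v <;> simp [bowtie]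
  rw [SimpleGraph.degree_eq_sum]
  simp only [h, Fin.sum_univ_five]
  fin_cases u <;> simp_all

theorem mainTheorem9 (f : ℝ → ℝ → ℝ) (hf : IsGoodEscalating f) (n k : ℕ) (hk : 1 ≤ k) :
    -- bicyclic graphs: the graph `F''_n(k)` exists and is extremal
    (k + 5 ≤ n →
      (∃ l : Fin k → ℕ, AlmostEqualLengths l ∧ 5 + ∑ i, l i = n) ∧
      ∀ l : Fin k → ℕ, AlmostEqualLengths l → 5 + ∑ i, l i = n →
        IsExtremalGraph hf.toIsEscalating 2 n k (attachPaths bowtie 0 l)) ∧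
    -- unicyclic graphs: the graph `F'_n(k)` exists and is extremal
    (k + 3 ≤ n →
      (∃ l : Fin k → ℕ, AlmostEqualLengths l ∧ 3 + ∑ i, l i = n) ∧
      ∀ l : Fin k → ℕ, AlmostEqualLengths l → 3 + ∑ i, l i = n → ∀ v : Fin 3,
        IsExtremalGraph hf.toIsEscalating 1 n k (attachPaths (SimpleGraph.cycleGraph 3) v l)) ∧
    -- trees: the graph `F_n(k)` exists and is extremal
    (2 ≤ k → k + 1 ≤ n →
      (∃ l : Fin k → ℕ, AlmostEqualLengths l ∧ 1 + ∑ i, l i = n) ∧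
      ∀ l : Fin k → ℕ, AlmostEqualLengths l → 1 + ∑ i, l i = n →
        IsExtremalGraph hf.toIsEscalating 0 n k (attachPaths (⊥ : SimpleGraph (Fin 1)) 0 l)) := by
  have hex : ∀ b, k + b ≤ n → ∃ l : Fin k → ℕ, AlmostEqualLengths l ∧ b + ∑ i, l i = n := by
    intro b hb
    obtain ⟨l, hl, hs⟩ := exists_almostEqualLengths hk (show k ≤ n - b by omega)
    exact ⟨l, hl, by omega⟩
  refine ⟨fun h => ⟨hex 5 h, fun l hl hn => ?_⟩, fun h => ⟨hex 3 h, fun l hl hn v => ?_⟩,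
    fun hk2 h => ⟨hex 1 h, fun l hl hn => ?_⟩⟩
  · exact isExtremalGraph_attachPaths hf le_rfl (by simp) bowtie_adj_zero bowtie_degree_eq_two
      (by omega) hl hn
  · rw [SimpleGraph.cycleGraph_three_eq_top]
    refine isExtremalGraph_attachPaths hf (by norm_num) (by simp) (fun u hu => ?_) (fun u _ => ?_)
      (by omega) hl hn
    · exact hu.symm
    · rw [SimpleGraph.degree_eq_sum]
      fin_cases u <;> simp [Fin.sum_univ_three]
  · exact isExtremalGraph_attachPaths hf (by norm_num) (by simp)
      (fun u hu => absurd (Subsingleton.elim u 0) hu)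
      (fun u hu => absurd (Subsingleton.elim u 0) hu) (by omega) hl hn
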